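/- Matroids are finite. For a matroid $\mathsf{M}$ with ground set $E$ let $\chi_{\mathsf M}(t)=\sum_{A\subseteq E}(-1)^{|A|}t^{\operatorname{rk}(E)-\operatorname{rk}(A)}$ be its characteristic polynomial, and for a flat $F$ let $\mathsf M^F$ be the restriction of $\mathsf M$ to $F$ and $\mathsf M_F$ the contraction of $\mathsf M$ by $F$. The Kazhdan–Lusztig polynomials $P_{\mathsf M}(t)\in\mathbb Z[t]$ are determined by: $P_{\mathsf M}=1$ if $\mathsf M$ is empty, $P_{\mathsf M}=0$ if $\mathsf M$ has rank $0$ and is not empty, $\deg P_{\mathsf M}<\operatorname{rk}(\mathsf M)/2$ if $\operatorname{rk}(\mathsf M)>0$, and $t^{\operatorname{rk}(\mathsf M)}P_{\mathsf M}(t^{-1})=\sum_F\chi_{\mathsf M^F}(t)P_{\mathsf M_F}(t)$, the sum being over all flats $F$ of $\mathsf M$. A hyperplane $H$ of a matroid $\mathsf M$ of rank $k$ is stressed if all subsets of $H$ of cardinality $k$ are circuits; its relaxation $\widetilde{\mathsf M}$ is the matroid on the same ground set whose bases are the bases of $\mathsf M$ and all subsets of $H$ of cardinality $k$. For integers $a,b\ge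 2$ and $i\ge 1$ consider the skew shape whose left-most column has $a$ boxes, followed by $i-1$ columns with two boxes and by a right-most column with $b$ boxes, where the two top boxes of the left-most column, all boxes of the middle columns and the two bottom boxes of the right-most column form two full rows of $i+1$ boxes each. Let $\overline{\operatorname{skyt}}(a,i,b)$ be the number of fillings of its $a+2i+b-2$ boxes with the integers $1,\dots,a+2i+b-2$, each used once, that increase strictly along rows from left to right and along columns from top to bottom, and that have the entry $1$ at the top of the left-most column. Put $\overline{\operatorname{skyt}}(a,i,b)=0$ if $i=0$ or $a<2$ or $b<2$. Let $k,h\ge 1$ be integers with $h\ge k-1$ (a hyperplane of a rank $k$ matroid has at least $k-1$ elements). There is exactly one polynomial $p_{k,h}(t)\in\mathbb Z[t]$ such that $P_{\widetilde{\mathsf M}}(t)=P_{\mathsf M}(t)+p_{k,h}(t)$ for every matroid $\mathsf M$ of rank $k$ and every relaxation $\widetilde{\mathsf M}$ of a stressed hyperplane of cardinality $h$ of $\mathsf M$. If $k\ge 2$, then $$p_{k,h}(t)=\sum_{i=0}^{\lfloor (k-1)/2\rfloor}\overline{\operatorname{skyt}}(h-k+2,\,i,\,k-2i+1)\,t^i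 ,$$ and $p_{1,h}(t)=1$. In particular, $p_{k,h}(t)$ has non-negative coefficients; it is $0$ if $k=2$ or $h=k-1$, and otherwise (that is, if $h\ge k$ and $k\ne 2$) it has degree exactly $\lfloor (k-1)/2\rfloor$. -/

import Mathlib

open Set Polynomial

universe u

namespace Matroid

/-- The rank of `X` in `M`, as a natural number. -/
noncomputable def natRk {α : Type*} (M : Matroid α) (X : Set α) : ℕ := (M.eRk X).toNat

/-- The rank of `M`, as a natural number. -/
noncomputable def natRank {α : Type*} (M : Matroid α) : ℕ := M.eRank.toNat

/-- A hyperplane is a flat whose rank is one less than the rank of the matroid. -/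
def IsHyperplane {α : Type*} (M : Matroid α) (H : Set α) : Prop :=
  M.IsFlat H ∧ M.eRk H + 1 = M.eRank

/-- A hyperplane `H` of a matroid of rank `k` is stressed if every subset of `H` of
cardinality `k` is a circuit. -/
def IsStressedHyperplane {α : Type*} (M : Matroid α) (H : Set α) : Prop :=
  M.IsHyperplane H ∧ ∀ S ⊆ H, S.encard = M.eRank → M.IsCircuit S

/-- The bases of the relaxation of `H`: the bases of `M`, and the subsets of `H` whose
cardinality is the rank of `M`. -/
def RelaxedIsBase {α : Type*} (M : Matroid α) (H B : Set α) : Prop :=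
  M.IsBase B ∨ (B ⊆ H ∧ B.encard = M.eRank)

theorem IsStressedHyperplane.exchangeProperty {α : Type*} {M : Matroid α} [M.Finite]
    {H : Set α} (hH : M.IsStressedHyperplane H) :
    Matroid.ExchangeProperty (M.RelaxedIsBase H) := by
  intro B₁ B₂ h₁ h₂ x hx
  have hrfin : M.eRank ≠ ⊤ := (eRank_ne_top_iff M).2 inferInstance
  have card : ∀ {B}, M.RelaxedIsBase H B → B.encard = M.eRank := by
    rintro B (h | h)
    · exact h.encard_eq_eRank
    · exact h.2
  have hI : M.Indep (B₁ \ {x}) := by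
    rcases h₁ with h | h
    · exact h.indep.sdiff _
    · exact (hH.2 B₁ h.1 h.2).sdiff_singleton_indep hx.1
  have hIcard : (B₁ \ {x}).encard + 1 = M.eRank := by
    rw [encard_sdiff_singleton_add_one hx.1, card h₁]
  have hIfin : (B₁ \ {x}).encard ≠ ⊤ := by
    intro h
    rw [h] at hIcard
    exact hrfin (by simpa using hIcard.symm)
  by_cases hcl : B₂ ⊆ M.closure (B₁ \ {x})
  · have hrk : M.eRk B₂ ≤ (B₁ \ {x}).encard := by
      rw [← hI.eRk_eq_encard, ← eRk_closure_eq M (B₁ \ {x})]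
      exact M.eRk_mono hcl
    rcases h₂ with h | h
    · rw [h.eRk_eq_eRank, ← hIcard] at hrk
      exact absurd hrk (not_le.2 ((ENat.lt_add_one_iff hIfin).2 le_rfl))
    · have hC := (hH.2 B₂ h.1 h.2).eRk_add_one_eq
      rw [h.2] at hC
      have hHr : M.eRk H = M.eRk B₂ :=
        (ENat.add_left_injective_of_ne_top (by simp : (1 : ℕ∞) ≠ ⊤)) (hH.1.2.trans hC.symm)
      have hIr : (B₁ \ {x}).encard = M.eRk B₂ :=
        (ENat.add_left_injective_of_ne_top (by simp : (1 : ℕ∞) ≠ ⊤)) (hIcard.trans hC.symm)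
      have e1 : M.closure B₂ = M.closure H :=
        (M.isRkFinite_set B₂).closure_eq_closure_of_subset_of_eRk_ge_eRk h.1 hHr.le
      have e2 : M.closure B₂ = M.closure (M.closure (B₁ \ {x})) :=
        (M.isRkFinite_set B₂).closure_eq_closure_of_subset_of_eRk_ge_eRk hcl
          (by rw [eRk_closure_eq, hI.eRk_eq_encard, hIr])
      have hIH : B₁ \ {x} ⊆ H := by
        have := M.subset_closure (B₁ \ {x}) hI.subset_ground
        rwa [← M.closure_closure, ← e2, e1, hH.1.1.closure] at this
      obtain ⟨y, hy⟩ : (B₂ \ B₁).Nonempty := by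
        rw [nonempty_iff_ne_empty, Ne, sdiff_eq_empty]
        intro hsub
        have hfin : B₂.Finite := by
          rw [← encard_ne_top_iff, h.2]; exact hrfin
        have := hfin.eq_of_subset_of_encard_le hsub (by rw [card h₁, h.2])
        exact hx.2 (this ▸ hx.1)
      refine ⟨y, hy, Or.inr ⟨insert_subset (h.1 hy.1) hIH, ?_⟩⟩
      rw [encard_insert_of_notMem (fun hyI => hy.2 hyI.1), hIcard]
  · obtain ⟨y, hy, hycl⟩ := not_subset.1 hcl
    have hB₂E : B₂ ⊆ M.E := by
      rcases h₂ with h | h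
      · exact h.subset_ground
      · exact h.1.trans hH.1.1.subset_ground
    have hyI : y ∉ B₁ \ {x} := fun h => hycl (M.subset_closure _ hI.subset_ground h)
    have hyB₁ : y ∉ B₁ := fun h => hyI ⟨h, fun hyx => hx.2 (by rw [← (show y = x from hyx)]; exact hy)⟩
    have hins : M.Indep (insert y (B₁ \ {x})) :=
      (hI.insert_indep_iff_of_notMem hyI).2 ⟨hB₂E hy, hycl⟩
    refine ⟨y, ⟨hy, hyB₁⟩, Or.inl ?_⟩
    refine hins.isBase_of_eRk_ge (M.set_finite _ hins.subset_ground) ?_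
    rw [hins.eRk_eq_encard, encard_insert_of_notMem hyI, hIcard]

/-- The relaxation of the stressed hyperplane `H` of the finite matroid `M`: the matroid on the
same ground set whose bases are those of `M` together with all subsets of `H` of cardinality
`rk M`. -/
def relax {α : Type*} (M : Matroid α) [M.Finite] (H : Set α) (hH : M.IsStressedHyperplane H) :
    Matroid α :=
  Matroid.ofIsBaseOfFinite M.ground_finite (M.RelaxedIsBase H)
    (M.exists_isBase.imp fun _ h => Or.inl h) hH.exchangeProperty
    (by
      rintro B (h | h)
      · exact h.subset_ground
      · exact h.1.trans hH.1.1.subset_ground)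

instance relax_finite {α : Type*} (M : Matroid α) [M.Finite] (H : Set α)
    (hH : M.IsStressedHyperplane H) : (M.relax H hH).Finite :=
  ⟨M.ground_finite⟩

/-- The characteristic polynomial
`χ_M(t) = ∑_{A ⊆ E} (-1)^|A| t^(rk M - rk A) = (-1)^(rk M) T_M(1 - t, 0)` of a finite matroid.
It vanishes if `M` has a loop; otherwise it is the characteristic polynomial of the lattice of
flats of `M`, see `charPoly_eq_finsum_moebius`. -/
noncomputable def charPoly {α : Type*} (M : Matroid α) : ℤ[X] :=
  ∑ᶠ A ∈ 𝒫 M.E, (-1) ^ A.ncard * X ^ (M.natRank - M.natRk A)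

theorem charPoly_eq_zero {α : Type*} (M : Matroid α) [M.Finite] {e : α} (he : M.IsLoop e) :
    charPoly M = 0 := by
  classical
  have hfin : (𝒫 M.E).Finite := M.ground_finite.finite_subsets
  rw [charPoly, finsum_mem_eq_finite_toFinset_sum _ hfin]
  have hrk : ∀ A, M.natRk (insert e A) = M.natRk A := fun A => by
    rw [natRk, natRk, ← union_singleton, M.eRk_eq_eRk_union_eRk_le_zero A he.eRk_eq.le]
  have key : ∀ A : Set α, A.Finite → e ∉ A →
      ((-1) ^ A.ncard * X ^ (M.natRank - M.natRk A) : ℤ[X]) +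
        (-1) ^ (insert e A).ncard * X ^ (M.natRank - M.natRk (insert e A)) = 0 := by
    intro A hA heA
    rw [hrk, ncard_insert_of_notMem heA hA, pow_succ]
    ring
  refine Finset.sum_involution (fun A _ => if e ∈ A then A \ {e} else insert e A) ?_ ?_ ?_ ?_
  · intro A hA
    have hA' : A ⊆ M.E := by simpa using hA
    have hAf : A.Finite := M.ground_finite.subset hA'
    split_ifs with h
    · have := key (A \ {e}) hAf.sdiff (by simp)
      rw [insert_sdiff_singleton, insert_eq_of_mem h] at this
      rw [add_comm]; exact this
    · exact key A hAf h
  · intro A _ _ hAe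
    split_ifs at hAe with h
    · rw [← hAe] at h; exact h.2 rfl
    · exact h (hAe ▸ mem_insert e A)
  · intro A hA
    have hA' : A ⊆ M.E := by simpa using hA
    split_ifs
    · exact (Finite.mem_toFinset _).2 (sdiff_subset.trans hA')
    · simpa using insert_subset he.mem_ground hA'
  · intro A _
    by_cases h : e ∈ A
    · simp [h]
    · simp [h]

/-- The characteristic polynomial of a loopless matroid is that of its lattice of flats, that is
`∑_F μ(∅, F) t^(rk M - rk F)`, where `μ(∅, ·)` is the Möbius function. -/
theorem charPoly_eq_finsum_moebius {α : Type*} (M : Matroid α) [M.Finite] [M.Loopless]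
    (μ : Set α → ℤ)
    (hμ : ∀ G, M.IsFlat G → ∑ᶠ F ∈ {F | M.IsFlat F ∧ F ⊆ G}, μ F = if G = ∅ then 1 else 0) :
    charPoly M = ∑ᶠ F ∈ {F | M.IsFlat F}, (μ F : ℤ[X]) * X ^ (M.natRank - M.natRk F) := by
  classical
  have hfin : (𝒫 M.E).Finite := M.ground_finite.finite_subsets
  have hflat : {F | M.IsFlat F}.Finite := hfin.subset fun F hF => hF.subset_ground
  have hflat' : ∀ G, {F | M.IsFlat F ∧ F ⊆ G}.Finite := fun G => hflat.subset fun F hF => hF.1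
  let g : Set α → ℤ := fun F =>
    ∑ A ∈ hfin.toFinset.filter (fun A => M.closure A = F), (-1) ^ A.ncard
  have hg : ∀ G, M.IsFlat G →
      ∑ F ∈ (hflat' G).toFinset, g F = if G = ∅ then 1 else 0 := by
    intro G hG
    have hGf := M.ground_finite.subset hG.subset_ground
    have h1 : ∑ F ∈ (hflat' G).toFinset, g F
        = ∑ A ∈ hfin.toFinset.filter (fun A => A ⊆ G), (-1) ^ A.ncard := by
      rw [← Finset.sum_fiberwise_of_maps_to (s := hfin.toFinset.filter (fun A => A ⊆ G))
        (t := (hflat' G).toFinset) (g := fun A => M.closure A)]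
      · refine Finset.sum_congr rfl fun F hF => Finset.sum_congr ?_ fun _ _ => rfl
        have hF' : M.IsFlat F ∧ F ⊆ G := by simpa using hF
        ext A
        simp only [Finset.mem_filter, Finite.mem_toFinset, mem_powerset_iff]
        constructor
        · rintro ⟨hA, rfl⟩
          exact ⟨⟨hA, (M.subset_closure A hA).trans hF'.2⟩, rfl⟩
        · rintro ⟨⟨hA, -⟩, h⟩
          exact ⟨hA, h⟩
      · intro A hA
        have hA' : A ⊆ M.E ∧ A ⊆ G := by simpa using hA
        simpa using (M.closure_subset_closure hA'.2).trans hG.closure.subset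
    rw [h1]
    have h2 : hfin.toFinset.filter (fun A => A ⊆ G)
        = hGf.toFinset.powerset.map
          ⟨fun s : Finset α => (s : Set α), Finset.coe_injective⟩ := by
      ext A
      simp only [Finset.mem_filter, Finite.mem_toFinset, mem_powerset_iff, Finset.mem_map,
        Finset.mem_powerset, Function.Embedding.coeFn_mk]
      constructor
      · rintro ⟨-, hA⟩
        exact ⟨(hGf.subset hA).toFinset, by simpa using hA, by simp⟩
      · rintro ⟨s, hs, rfl⟩
        have : (s : Set α) ⊆ G := by
          intro x hx
          simpa using hs hx
        exact ⟨this.trans hG.subset_ground, this⟩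
    rw [h2, Finset.sum_map]
    simp only [Function.Embedding.coeFn_mk, ncard_coe_finset]
    rw [Finset.sum_powerset_neg_one_pow_card]
    simp
  have hμg : ∀ n : ℕ, ∀ F, M.IsFlat F → F.ncard = n → μ F = g F := by
    intro n
    induction n using Nat.strong_induction_on with
    | _ n ih =>
      intro F hF hn
      have hFf := M.ground_finite.subset hF.subset_ground
      have e1 := hμ F hF
      rw [finsum_mem_eq_finite_toFinset_sum _ (hflat' F), ← hg F hF] at e1
      have hmem : F ∈ (hflat' F).toFinset := by simpa using hF
      rw [← Finset.add_sum_erase _ _ hmem, ← Finset.add_sum_erase _ _ hmem] at e1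
      have e2 : ∑ G ∈ (hflat' F).toFinset.erase F, μ G
          = ∑ G ∈ (hflat' F).toFinset.erase F, g G := by
        refine Finset.sum_congr rfl fun G hG => ?_
        have hG' : G ≠ F ∧ M.IsFlat G ∧ G ⊆ F := by simpa using hG
        exact ih G.ncard (hn ▸ ncard_lt_ncard (hG'.2.2.ssubset_of_ne hG'.1) hFf) G hG'.2.1 rfl
      rw [e2] at e1
      exact add_right_cancel e1
  rw [charPoly, finsum_mem_eq_finite_toFinset_sum _ hfin,
    finsum_mem_eq_finite_toFinset_sum _ hflat,
    ← Finset.sum_fiberwise_of_maps_to (t := hflat.toFinset) (g := fun A => M.closure A)]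
  · refine Finset.sum_congr rfl fun F hF => ?_
    rw [hμg _ F (by simpa using hF) rfl]
    simp only [g, Int.cast_sum, Finset.sum_mul]
    refine Finset.sum_congr rfl fun A hA => ?_
    have hA' : M.closure A = F := (Finset.mem_filter.1 hA).2
    rw [← hA', natRk, natRk, eRk_closure_eq]
    simp
  · intro A _
    simp

/-- The truncation of a polynomial to the powers `t ^ i` with `i < r / 2`. -/
noncomputable def lowerHalf (r : ℕ) (R : ℤ[X]) : ℤ[X] :=
  ∑ i ∈ (Finset.range r).filter (fun i => 2 * i < r), monomial i (R.coeff i)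

/-- The Kazhdan–Lusztig polynomial of a finite matroid. It is the solution of
* `P_M = 1` if `M` is empty, and `P_M = 0` if `rk M = 0` and `M` is not empty;
* `deg P_M < rk M / 2` if `rk M > 0`;
* `t ^ (rk M) * P_M (t⁻¹) = ∑_F χ_{M^F} (t) * P_{M_F} (t)`, the sum being over all flats `F`.

If `∅` is a flat, it contributes `P_M` to the last sum, so that the sum `R` over the flats
`F ≠ ∅` is `t ^ (rk M) * P_M (t⁻¹) - P_M`, where the first term has only powers of `t` beyond
`rk M / 2`, and `P_M` is minus the lower half of `R`. If `∅` is not a flat, `R = 0 = P_M`.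
Here `M^F` is the restriction `M ↾ F` and `M_F` the contraction `M ／ F`.
See `klPoly_unique`. -/
noncomputable def klPoly {α : Type*} (M : Matroid α) [M.Finite] : ℤ[X] :=
  open Classical in
  if M.eRank = 0 then (if M.E = ∅ then 1 else 0)
  else - lowerHalf M.natRank
    (∑ᶠ F : {F : Set α // M.IsFlat F ∧ F.Nonempty}, charPoly (M ↾ F.1) * klPoly (M ／ F.1))
termination_by M.E.ncard
decreasing_by
  have hF := F.2.1.subset_ground
  exact ncard_lt_ncard (⟨sdiff_subset, fun h => F.2.2.elim fun x hx => (h (hF hx)).2 hx⟩) M.ground_finite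

/-- A family of polynomials that satisfies the three defining conditions of the
Kazhdan–Lusztig polynomials coincides with `klPoly`. -/
theorem klPoly_unique {α : Type*} (P : Matroid α → ℤ[X])
    (h0 : ∀ M : Matroid α, M.Finite → M.eRank = 0 →
      (M.E = ∅ → P M = 1) ∧ (M.E ≠ ∅ → P M = 0))
    (hdeg : ∀ M : Matroid α, M.Finite → M.eRank ≠ 0 → 2 * (P M).natDegree < M.natRank)
    (hrec : ∀ M : Matroid α, M.Finite → reflect M.natRank (P M) =
      ∑ᶠ F ∈ {F | M.IsFlat F}, charPoly (M ↾ F) * P (M ／ F))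
    (M : Matroid α) [hM : M.Finite] : klPoly M = P M := by
  classical
  have main : ∀ n : ℕ, ∀ M : Matroid α, ∀ _ : M.Finite, M.E.ncard = n → klPoly M = P M := by
    intro n
    induction n using Nat.strong_induction_on with
    | _ n ih =>
    intro M hM hn
    rw [klPoly]
    split_ifs with hr hE
    · exact ((h0 M hM hr).1 hE).symm
    · exact ((h0 M hM hr).2 hE).symm
    have hfin : {F | M.IsFlat F ∧ F.Nonempty}.Finite :=
      M.ground_finite.finite_subsets.subset fun F hF => hF.1.subset_ground
    have e1 : (∑ᶠ F : {F : Set α // M.IsFlat F ∧ F.Nonempty},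
          charPoly (M ↾ F.1) * klPoly (M ／ F.1))
        = ∑ᶠ F ∈ {F | M.IsFlat F ∧ F.Nonempty}, charPoly (M ↾ F) * P (M ／ F) := by
      rw [← finsum_set_coe_eq_finsum_mem]
      refine finsum_congr fun F => ?_
      have hF := F.2.1.subset_ground
      rw [ih (M ／ F.1).E.ncard ?_ (M ／ F.1) inferInstance rfl]
      rw [← hn]
      exact ncard_lt_ncard ⟨sdiff_subset, fun h => F.2.2.elim fun x hx => (h (hF hx)).2 hx⟩
        M.ground_finite
    rw [e1]
    by_cases h : M.IsFlat ∅
    · have hset : {F | M.IsFlat F} = insert ∅ {F | M.IsFlat F ∧ F.Nonempty} := by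
        ext F
        rcases F.eq_empty_or_nonempty with rfl | hF
        · simpa using h
        · simp [hF, hF.ne_empty]
      have hchi : charPoly (M ↾ (∅ : Set α)) = 1 := by
        rw [charPoly]
        simp [natRank, natRk]
      have hR := hrec M hM
      rw [hset, finsum_mem_insert _ (by simp) hfin, hchi, one_mul, contract_empty] at hR
      rw [← sub_eq_iff_eq_add'] at hR
      rw [← hR, lowerHalf]
      have hd := hdeg M hM hr
      ext j
      simp only [coeff_neg, finsetSum_coeff, coeff_monomial, coeff_sub]
      rw [Finset.sum_ite_eq']
      simp only [Finset.mem_filter, Finset.mem_range]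
      split_ifs with hj
      · rw [coeff_reflect, revAt_le hj.1.le,
          coeff_eq_zero_of_natDegree_lt (by omega : (P M).natDegree < M.natRank - j)]
        simp
      · rw [coeff_eq_zero_of_natDegree_lt (by omega : (P M).natDegree < j)]
        simp
    · obtain ⟨e, he⟩ : M.loops.Nonempty := by
        rw [nonempty_iff_ne_empty]
        intro hl
        apply h
        rw [isFlat_iff_closure_eq]
        exact hl
      have hz : ∀ F, M.IsFlat F → charPoly (M ↾ F) = 0 := by
        intro F hF
        have : (M ↾ F).Finite := M.restrict_finite (M.ground_finite.subset hF.subset_ground)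
        refine charPoly_eq_zero (M ↾ F) (e := e) ?_
        rw [restrict_isLoop_iff]
        exact ⟨hF.loops_subset he, Or.inl he⟩
      have hR := hrec M hM
      rw [finsum_mem_congr rfl (g := fun _ => 0) (fun F hF => by rw [hz F hF, zero_mul])] at hR
      rw [finsum_mem_congr rfl (g := fun _ => 0) (fun F hF => by rw [hz F hF.1, zero_mul])]
      simp only [finsum_mem_zero] at hR ⊢
      rw [(reflect_eq_zero_iff).1 hR]
      simp [lowerHalf]
  exact main _ M hM rfl

end Matroid

open Matroid in
/-- `p` is the polynomial by which the Kazhdan–Lusztig polynomial of any matroid of rank `k`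
changes when a stressed hyperplane of cardinality `h` is relaxed. -/
def IsKLRelaxationPoly (k h : ℕ) (p : ℤ[X]) : Prop :=
  ∀ (α : Type u) (M : Matroid α) [M.Finite] (H : Set α) (hH : M.IsStressedHyperplane H),
    M.eRank = k → H.encard = h → (M.relax H hH).klPoly = M.klPoly + p

/-- The boxes of the skew shape `Skyt(a, i, b)` for `a, b ≥ 2` and `i ≥ 1`, as pairs
(row, column), rows numbered from top to bottom and columns from left to right, both from `0`.
Column `0` has `a` boxes, columns `1, …, i - 1` have two boxes and column `i` has `b` boxes.
The two top boxes of columns `0, …, i - 1` lie in the rows of the two bottom boxes of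
column `i`. -/
def skytBoxes (a i b : ℕ) : Finset (ℕ × ℕ) :=
  (Finset.Ico (b - 2) (b - 2 + a) ×ˢ {0}) ∪ (Finset.Ico (b - 2) b ×ˢ Finset.Ico 1 i) ∪
    (Finset.range b ×ˢ {i})

/-- The legal fillings of the skew shape: each of the integers `1, …, a + 2 i + b - 2` is used
exactly once, and the values increase strictly along rows (from left to right) and along columns
(from top to bottom). -/
def Skyt (a i b : ℕ) : Set (skytBoxes a i b → Finset.Icc 1 (a + 2 * i + b - 2)) :=
  {T | Function.Bijective T ∧
    (∀ c d : skytBoxes a i b, c.1.1 = d.1.1 → c.1.2 < d.1.2 → T c < T d) ∧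
    (∀ c d : skytBoxes a i b, c.1.2 = d.1.2 → c.1.1 < d.1.1 → T c < T d)}

/-- The legal fillings that have the entry `1` at the top of the left-most column. -/
def SkytBar (a i b : ℕ) : Set (skytBoxes a i b → Finset.Icc 1 (a + 2 * i + b - 2)) :=
  {T | T ∈ Skyt a i b ∧ ∀ c : skytBoxes a i b, c.1 = (b - 2, 0) → (T c : ℕ) = 1}

/-- The number of restricted skew Young tableaux, with the convention that it is `0` if `i = 0`
or if `a` or `b` is less than `2`. -/
noncomputable def skytBar (a i b : ℕ) : ℕ :=
  if i = 0 ∨ a < 2 ∨ b < 2 then 0 else (SkytBar a i b).ncard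

/-!
The relaxation changes the summands of the Kazhdan–Lusztig recursion only for the ground set and for
subsets `A` of the stressed hyperplane `H`. If `A` has fewer than `k` elements, it is independent,
and the contraction of the relaxation by `A` is the relaxation of the contraction at `H \ A`, a
stressed hyperplane again; if `A` is larger, it spans the relaxation. With `d = h - k` fixed,
induction on `k` therefore reduces the theorem to a recursion for the polynomials `p_{k,k+d}` alone:
the sum over `A ⊆ H` is a generalized binomial transform with parameter `t - 1`, and the
characteristic polynomials at the ground set and at `H` contribute an inhomogeneous term.

Composing with the binomial transform with parameter `1` turns the recursion into a symmetry of the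
coefficients of `∑ l, (k + d choose l + d) t ^ (k - l) p_{l,l+d}(t)`. To verify it, the numbers of
restricted skew tableaux are written in closed form: the right-most column of the skew shape is
detached from the other boxes by inclusion–exclusion, and what remains are tableaux of shapes
`(r₁, r₂, 1, …, 1)`, which the hook length formula counts. In the closed form the symmetry comes
from the antisymmetry of a weight on pairs of integers.
-/

namespace KLRelaxation

open Matroid

section LinearExtensions

variable {β : Type*} {R : β → β → Prop} {S : Finset β} {T : β → ℕ} {x : β}

/-- The linear extensions of the relation `R` on the finite set `S`, as functions that number
the elements of `S` by `1, …, |S|` and vanish outside of `S`. -/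
def linearExtensions (R : β → β → Prop) (S : Finset β) : Set (β → ℕ) :=
  {T | BijOn T S (Icc 1 S.card) ∧ (∀ x ∉ S, T x = 0) ∧ ∀ x ∈ S, ∀ y ∈ S, R x y → T x < T y}

theorem linearExtensions_empty (R : β → β → Prop) : linearExtensions R ∅ = {0} := by
  ext T
  simp [linearExtensions, funext_iff]

theorem apply_mem_Icc_of_mem_linearExtensions (hT : T ∈ linearExtensions R S) (hx : x ∈ S) :
    1 ≤ T x ∧ T x ≤ S.card :=
  hT.1.mapsTo hx

theorem exists_apply_eq_card (hT : T ∈ linearExtensions R S) (hS : S.Nonempty) :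
    ∃ x ∈ S, T x = S.card :=
  hT.1.surjOn ⟨hS.card_pos, le_rfl⟩

theorem not_rel_of_apply_eq_card (hT : T ∈ linearExtensions R S) (hx : x ∈ S)
    (hTx : T x = S.card) {y : β} (hy : y ∈ S) : ¬ R x y := fun hxy =>
  ((hT.2.2 x hx y hy hxy).trans_le (apply_mem_Icc_of_mem_linearExtensions hT hy).2).ne hTx

theorem bijOn_update_card [DecidableEq β] (hx : x ∈ S)
    (hT : BijOn T (S.erase x) (Icc 1 (S.erase x).card)) :
    BijOn (Function.update T x S.card) S (Icc 1 S.card) := by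
  have hcard := Finset.card_erase_add_one hx
  have hcongr : BijOn (Function.update T x S.card) (S.erase x) (Icc 1 (S.erase x).card) :=
    hT.congr fun y hy => (Function.update_of_ne (Finset.ne_of_mem_erase hy) _ _).symm
  have hinsert := hcongr.insert (a := x) (by simp [← hcard])
  rwa [← Finset.coe_insert, Finset.insert_erase hx, Function.update_self, ← hcard,
    Set.insert_Icc_right_eq_Icc_add_one (by omega), hcard] at hinsert

theorem update_card_mem_linearExtensions [DecidableEq β] (hx : x ∈ S) (hmax : ∀ y ∈ S, ¬ R x y)
    (hT : T ∈ linearExtensions R (S.erase x)) :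
    Function.update T x S.card ∈ linearExtensions R S := by
  refine ⟨bijOn_update_card hx hT.1, fun y hy => ?_, fun y hy z hz hyz => ?_⟩
  · rw [Function.update_of_ne (ne_of_mem_of_not_mem hx hy).symm]
    exact hT.2.1 y fun h => hy (Finset.mem_of_mem_erase h)
  · have hyx : y ≠ x := by
      rintro rfl
      exact hmax z hz hyz
    have hy' : y ∈ S.erase x := Finset.mem_erase.2 ⟨hyx, hy⟩
    rcases eq_or_ne z x with rfl | hzx
    · rw [Function.update_self, Function.update_of_ne hyx]
      exact (apply_mem_Icc_of_mem_linearExtensions hT hy').2.trans_lt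
        (Finset.card_erase_lt_of_mem hx)
    · rw [Function.update_of_ne hyx, Function.update_of_ne hzx]
      exact hT.2.2 y hy' z (Finset.mem_erase.2 ⟨hzx, hz⟩) hyz

theorem update_zero_mem_linearExtensions [DecidableEq β] (hx : x ∈ S)
    (hT : T ∈ linearExtensions R S) (hTx : T x = S.card) :
    Function.update T x 0 ∈ linearExtensions R (S.erase x) := by
  have hcongr : EqOn T (Function.update T x 0) (S.erase x) := fun y hy =>
    (Function.update_of_ne (Finset.ne_of_mem_erase hy) _ _).symm
  refine ⟨?_, fun y hy => ?_, fun y hy z hz hyz => ?_⟩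
  · have herase : BijOn T ((S : Set β) \ {x}) (Icc 1 S.card \ {T x}) := hT.1.sdiff_singleton hx
    rw [hTx, Icc_sdiff_right, ← Finset.coe_erase, ← Finset.card_erase_add_one hx,
      Ico_add_one_right_eq_Icc] at herase
    exact herase.congr hcongr
  · rcases eq_or_ne y x with rfl | hyx
    · exact Function.update_self ..
    · rw [Function.update_of_ne hyx]
      exact hT.2.1 y fun h => hy (Finset.mem_erase.2 ⟨hyx, h⟩)
  · rw [← hcongr hy, ← hcongr hz]
    exact hT.2.2 y (Finset.mem_of_mem_erase hy) z (Finset.mem_of_mem_erase hz) hyz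

theorem bijOn_update_card_linearExtensions [DecidableEq β] (hx : x ∈ S) (hmax : ∀ y ∈ S, ¬ R x y) :
    BijOn (fun T => Function.update T x S.card) (linearExtensions R (S.erase x))
      {T ∈ linearExtensions R S | T x = S.card} := by
  refine BijOn.mk (fun T hT => ⟨update_card_mem_linearExtensions hx hmax hT, by simp⟩)
    (fun T hT T' hT' h => ?_) fun T hT =>
      ⟨_, update_zero_mem_linearExtensions hx hT.1 hT.2, by simp [← hT.2]⟩
  have hzero : T x = T' x := by rw [hT.2.1 x (by simp), hT'.2.1 x (by simp)]
  have hupdate := congrArg (Function.update · x (T x)) h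
  simp only [Function.update_idem, Function.update_eq_self] at hupdate
  rwa [hzero, Function.update_eq_self] at hupdate

open Classical in
theorem linearExtensions_eq_biUnion (hS : S.Nonempty) :
    linearExtensions R S =
      ⋃ x ∈ S.filter (∀ y ∈ S, ¬ R · y), {T ∈ linearExtensions R S | T x = S.card} := by
  ext T
  simp only [mem_iUnion, exists_prop, mem_ofPred_eq, Finset.mem_filter]
  refine ⟨fun hT => ?_, fun ⟨_, _, hT, _⟩ => hT⟩
  obtain ⟨x, hx, hTx⟩ := exists_apply_eq_card hT hS
  exact ⟨x, ⟨hx, fun y => not_rel_of_apply_eq_card hT hx hTx⟩, hT, hTx⟩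

theorem linearExtensions_finite (R : β → β → Prop) (S : Finset β) :
    (linearExtensions R S).Finite := by
  classical
  induction S using Finset.strongInduction with
  | _ S ih =>
    rcases S.eq_empty_or_nonempty with rfl | hS
    · rw [linearExtensions_empty]
      exact finite_singleton _
    · rw [linearExtensions_eq_biUnion hS]
      refine Finite.biUnion (Finset.finite_toSet _) fun x hx => ?_
      obtain ⟨hx, hmax⟩ := Finset.mem_filter.1 hx
      rw [← (bijOn_update_card_linearExtensions hx hmax).image_eq]
      exact (ih _ (Finset.erase_ssubset hx)).image _

open Classical in
theorem ncard_linearExtensions_eq_sum [DecidableEq β] (hS : S.Nonempty) :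
    (linearExtensions R S).ncard =
      ∑ x ∈ S with ∀ y ∈ S, ¬ R x y, (linearExtensions R (S.erase x)).ncard := by
  have hdisj : ((S.filter (∀ y ∈ S, ¬ R · y) : Finset β) : Set β).PairwiseDisjoint
      fun x => {T ∈ linearExtensions R S | T x = S.card} := by
    refine fun x hx y hy hxy => disjoint_left.2 fun T hTx hTy => hxy ?_
    exact hTx.1.1.injOn (Finset.mem_filter.1 hx).1 (Finset.mem_filter.1 hy).1
      (hTx.2.trans hTy.2.symm)
  conv_lhs => rw [linearExtensions_eq_biUnion hS]
  refine (Finite.ncard_biUnion (Finset.finite_toSet _)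
    (fun _ _ => (linearExtensions_finite R S).subset (sep_subset _ _)) hdisj).trans ?_
  rw [finsum_mem_coe_finset]
  refine Finset.sum_congr rfl fun x hx => ?_
  obtain ⟨hx, hmax⟩ := Finset.mem_filter.1 hx
  have hbij := bijOn_update_card_linearExtensions hx hmax
  rw [← hbij.image_eq, hbij.injOn.ncard_image]

theorem linearExtensions_nonempty_of_strictMono (f : β → ℕ)
    (hf : ∀ x ∈ S, ∀ y ∈ S, R x y → f x < f y) : (linearExtensions R S).Nonempty := by
  classical
  induction S using Finset.strongInduction with
  | _ S ih =>
    rcases S.eq_empty_or_nonempty with rfl | hS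
    · exact ⟨0, by rw [linearExtensions_empty]; rfl⟩
    · obtain ⟨x, hx, hmax⟩ := S.exists_max_image f hS
      obtain ⟨T, hT⟩ := ih _ (Finset.erase_ssubset hx) fun y hy z hz =>
        hf y (Finset.mem_of_mem_erase hy) z (Finset.mem_of_mem_erase hz)
      exact ⟨_, update_card_mem_linearExtensions hx
        (fun y hy hxy => (hf x hx y hy hxy).not_ge (hmax y hy)) hT⟩

theorem bijOn_extend_linearExtensions (R : β → β → Prop) {n : ℕ} (hn : S.card = n) :
    BijOn (fun T : S → Finset.Icc 1 n => Function.extend Subtype.val (fun x => (T x : ℕ)) 0)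
      {T | Function.Bijective T ∧ ∀ x y : S, R x y → T x < T y} (linearExtensions R S) := by
  have extend_apply (T : S → Finset.Icc 1 n) (x : S) :
      Function.extend Subtype.val (fun x => (T x : ℕ)) 0 x = T x :=
    Subtype.val_injective.extend_apply ..
  refine BijOn.mk (fun T hT => ⟨⟨fun x hx => ?_, fun x hx y hy hxy => ?_, fun m hm => ?_⟩,
    fun x hx => ?_, fun x hx y hy hxy => ?_⟩) (fun T _ T' _ h => ?_) fun T hT => ?_
  · rw [extend_apply T ⟨x, hx⟩, hn]
    exact Finset.mem_Icc.1 (T ⟨x, hx⟩).2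
  · rw [extend_apply T ⟨x, hx⟩, extend_apply T ⟨y, hy⟩] at hxy
    exact Subtype.mk.inj (hT.1.1 (Subtype.ext hxy))
  · obtain ⟨x, hx⟩ := hT.1.2 ⟨m, Finset.mem_Icc.2 (hn ▸ hm)⟩
    exact ⟨x, x.2, by rw [extend_apply, hx]⟩
  · exact Function.extend_apply' _ _ _ fun ⟨y, hy⟩ => hx (hy ▸ y.2)
  · rw [extend_apply T ⟨x, hx⟩, extend_apply T ⟨y, hy⟩]
    exact hT.2 ⟨x, hx⟩ ⟨y, hy⟩ hxy
  · funext x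
    rw [← Subtype.coe_inj, ← extend_apply T, ← extend_apply T']
    exact congrFun h x
  · have hmaps (x : S) : T x ∈ Finset.Icc 1 n := Finset.mem_Icc.2 (hn ▸ hT.1.mapsTo x.2)
    refine ⟨fun x => ⟨T x, hmaps x⟩, ⟨⟨fun x y hxy => ?_, fun m => ?_⟩,
      fun x y => hT.2.2 x x.2 y y.2⟩, funext fun x => ?_⟩
    · exact Subtype.ext (hT.1.injOn x.2 y.2 (Subtype.mk.inj hxy))
    · obtain ⟨x, hx, hxm⟩ := hT.1.surjOn (by rw [hn]; exact Finset.mem_Icc.1 m.2)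
      exact ⟨⟨x, hx⟩, Subtype.ext hxm⟩
    · by_cases hx : x ∈ S
      · exact extend_apply _ ⟨x, hx⟩
      · rw [hT.2.1 x hx]
        exact Function.extend_apply' _ _ _ fun ⟨y, hy⟩ => hx (hy ▸ y.2)

end LinearExtensions

section NearHooks

variable {r₁ r₂ e : ℕ}

/-- The triples `(r₁, r₂, e)` for which `(r₁, r₂, 1, …, 1)`, with `e` parts equal to `1` after the
first two, is a partition of a positive integer. -/
def IsNearHook (r₁ r₂ e : ℕ) : Prop :=
  1 ≤ r₁ ∧ r₂ ≤ r₁ ∧ (r₂ = 0 → e = 0)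

/-- The sum of a function on near-hooks over the near-hooks that arise from `(r₁, r₂, 1, …, 1)` by
removing a corner. -/
def cornerSum {A : Type*} [AddCommMonoid A] (f : ℕ → ℕ → ℕ → A) (r₁ r₂ e : ℕ) : A :=
  (if r₂ < r₁ ∧ 2 ≤ r₁ then f (r₁ - 1) r₂ e else 0) +
  (if 1 ≤ r₂ ∧ (2 ≤ r₂ ∨ e = 0) then f r₁ (r₂ - 1) e else 0) +
  (if 1 ≤ e then f r₁ r₂ (e - 1) else 0)

theorem cornerSum_congr {A : Type*} [AddCommMonoid A] {f g : ℕ → ℕ → ℕ → A}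
    (h : IsNearHook r₁ r₂ e)
    (hfg : ∀ s₁ s₂ s₃, IsNearHook s₁ s₂ s₃ → s₁ ≤ r₁ → s₁ + s₂ + s₃ + 1 = r₁ + r₂ + e →
      f s₁ s₂ s₃ = g s₁ s₂ s₃) : cornerSum f r₁ r₂ e = cornerSum g r₁ r₂ e := by
  simp only [IsNearHook] at h hfg
  refine congrArg₂ _ (congrArg₂ _ ?_ ?_) ?_ <;> split_ifs
  · exact hfg _ _ _ (by omega) (by omega) (by omega)
  · rfl
  · exact hfg _ _ _ (by omega) (by omega) (by omega)
  · rfl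
  · exact hfg _ _ _ (by omega) (by omega) (by omega)
  · rfl

theorem cast_cornerSum {A : Type*} [AddCommMonoidWithOne A] (f : ℕ → ℕ → ℕ → ℕ) :
    ((cornerSum f r₁ r₂ e : ℕ) : A) = cornerSum (fun s₁ s₂ s₃ => (f s₁ s₂ s₃ : A)) r₁ r₂ e := by
  simp only [cornerSum, Nat.cast_add, Nat.cast_ite, Nat.cast_zero]

theorem cornerSum_const_mul {A : Type*} [NonUnitalNonAssocSemiring A] (a : A)
    (f : ℕ → ℕ → ℕ → A) :
    cornerSum (fun s₁ s₂ s₃ => a * f s₁ s₂ s₃) r₁ r₂ e = a * cornerSum f r₁ r₂ e := by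
  simp only [cornerSum, mul_add, mul_ite, mul_zero]

/-- The number of standard Young tableaux of shape `(r₁, r₂, 1, …, 1)` with `e` parts equal to
`1` after the first two, by the hook length formula. The factor `r₂` cancels one of `r₂!`, and
makes the formula vanish if `r₂ = 0 < e`. -/
def nearHookCount (r₁ r₂ e : ℕ) : ℚ :=
  if r₂ + e = 0 then 1 else
    ((r₁ + r₂ + e).factorial * (r₁ + 1 - r₂) * r₂ : ℚ) /
      ((r₁ + e + 1) * (r₂ + e) * (e.factorial * r₁.factorial * r₂.factorial))

theorem nearHookCount_eq (h : 0 < r₂ + e) :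
    nearHookCount r₁ r₂ e = ((r₁ + r₂ + e).factorial * (r₁ + 1 - r₂) * r₂ : ℚ) /
      ((r₁ + e + 1) * (r₂ + e) * (e.factorial * r₁.factorial * r₂.factorial)) :=
  if_neg h.ne'

theorem nearHookCount_remove_first_row {w v e : ℕ} (h : v ≤ w) :
    (if v + 1 < w + 1 ∧ 2 ≤ w + 1 then nearHookCount (w + 1 - 1) (v + 1) e else 0) =
      (w + 1) * (w - v) * ((w + v + 1 + e).factorial : ℚ) / ((w + e + 1) * (v + 1 + e) *
        (e.factorial * (w + 1).factorial * v.factorial)) := by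
  split_ifs with hvw
  · rw [nearHookCount_eq (by omega), Nat.add_sub_cancel, Nat.factorial_succ w,
      Nat.factorial_succ v, ← add_assoc]
    push_cast
    field_simp
    ring
  · obtain rfl : v = w := by omega
    simp

theorem nearHookCount_remove_leg {w v e : ℕ} :
    (if 1 ≤ e then nearHookCount (w + 1) (v + 1) (e - 1) else 0) =
      e * (w + 1 - v) * ((w + v + 1 + e).factorial : ℚ) / ((w + e + 1) * (v + e) *
        (e.factorial * (w + 1).factorial * v.factorial)) := by
  rcases e with _ | e
  · simp
  · rw [if_pos (by omega), nearHookCount_eq (by omega), Nat.add_sub_cancel,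
      Nat.factorial_succ e, Nat.factorial_succ v,
      show w + 1 + (v + 1) + e = w + v + 1 + (e + 1) by ring]
    push_cast
    field_simp
    ring

theorem cornerSum_nearHookCount (h : IsNearHook r₁ r₂ e) (hsize : 2 ≤ r₁ + r₂ + e) :
    cornerSum nearHookCount r₁ r₂ e = nearHookCount r₁ r₂ e := by
  obtain ⟨h₁, h₂₁, he⟩ := h
  obtain ⟨w, rfl⟩ : ∃ w, r₁ = w + 1 := ⟨r₁ - 1, by omega⟩
  rcases r₂ with _ | v
  · obtain rfl := he rfl
    simp [cornerSum, nearHookCount, show 1 ≤ w by omega]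
  rw [cornerSum, nearHookCount_remove_first_row (by omega), nearHookCount_remove_leg]
  rcases Nat.eq_zero_or_pos (v + e) with h0 | h0
  · obtain ⟨rfl, rfl⟩ : v = 0 ∧ e = 0 := by omega
    simp [nearHookCount, Nat.factorial_succ, field]
  rw [ite_eq_left_iff.2 fun hv => ?_, nearHookCount_eq (by omega), nearHookCount_eq (by omega),
    Nat.factorial_succ v, show w + 1 + (v + 1) + e = w + v + 1 + e + 1 by ring,
    Nat.factorial_succ (w + v + 1 + e), Nat.add_sub_cancel,
    show w + 1 + v + e = w + v + 1 + e by ring]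
  · have hve : (v + e : ℚ) ≠ 0 := by exact_mod_cast h0.ne'
    push_cast
    field_simp
    ring
  · obtain rfl : v = 0 := by omega
    simp [nearHookCount, show e ≠ 0 by omega]

end NearHooks

section SkewTableaux

variable {c i r₁ r₂ e c' : ℕ}

/-- The boxes of the diagram with rows `c` and `c + 1` of lengths `r₁` and `r₂`, with `e` further
boxes below the first box of row `c + 1`, and with `c'` boxes in column `i`, from row `0` on. -/
def skewBoxes (c i r₁ r₂ e c' : ℕ) : Finset (ℕ × ℕ) :=
  {c} ×ˢ Finset.range r₁ ∪ {c + 1} ×ˢ Finset.range r₂ ∪ Finset.Ico (c + 2) (c + 2 + e) ×ˢ {0} ∪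
    Finset.range c' ×ˢ {i}

theorem mem_skewBoxes {x y : ℕ} :
    (x, y) ∈ skewBoxes c i r₁ r₂ e c' ↔ (x = c ∧ y < r₁) ∨ (x = c + 1 ∧ y < r₂) ∨
      (c + 2 ≤ x ∧ x < c + 2 + e ∧ y = 0) ∨ (x < c' ∧ y = i) := by
  simp only [skewBoxes, Finset.mem_union, Finset.mem_product, Finset.mem_singleton,
    Finset.mem_range, Finset.mem_Ico]
  tauto

theorem skewBoxes_erase_row (h₁ : 1 ≤ r₁) (hc : c' ≤ c) :
    (skewBoxes c i r₁ r₂ e c').erase (c, r₁ - 1) = skewBoxes c i (r₁ - 1) r₂ e c' := by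
  ext ⟨x, y⟩
  simp only [Finset.mem_erase, mem_skewBoxes, ne_eq, Prod.mk.injEq]
  omega

theorem skewBoxes_erase_second_row (h₂ : 1 ≤ r₂) (hc : c' ≤ c) :
    (skewBoxes c i r₁ r₂ e c').erase (c + 1, r₂ - 1) = skewBoxes c i r₁ (r₂ - 1) e c' := by
  ext ⟨x, y⟩
  simp only [Finset.mem_erase, mem_skewBoxes, ne_eq, Prod.mk.injEq]
  omega

theorem skewBoxes_erase_leg (he : 1 ≤ e) (hc : c' ≤ c) :
    (skewBoxes c i r₁ r₂ e c').erase (c + 1 + e, 0) = skewBoxes c i r₁ r₂ (e - 1) c' := by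
  ext ⟨x, y⟩
  simp only [Finset.mem_erase, mem_skewBoxes, ne_eq, Prod.mk.injEq]
  omega

theorem skewBoxes_erase_column (hc' : 1 ≤ c') (hc : c' ≤ c) :
    (skewBoxes c i r₁ r₂ e c').erase (c' - 1, i) = skewBoxes c i r₁ r₂ e (c' - 1) := by
  ext ⟨x, y⟩
  simp only [Finset.mem_erase, mem_skewBoxes, ne_eq, Prod.mk.injEq]
  omega

/-- The relation on boxes given by the order along rows and along columns, and by making `(c, 0)`
the least box. -/
def skewRel (c : ℕ) (x y : ℕ × ℕ) : Prop :=
  (x.1 = y.1 ∧ x.2 < y.2) ∨ (x.2 = y.2 ∧ x.1 < y.1) ∨ (x = (c, 0) ∧ y ≠ x)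

theorem forall_not_skewRel_iff {x y : ℕ} (hi : 1 ≤ i) (h : IsNearHook r₁ r₂ e) (h₁i : r₁ ≤ i + 1)
    (hc : c' ≤ c) (hcc : r₁ = i + 1 → c' = c) (hsize : 2 ≤ r₁ + r₂ + e + c') :
    ((x, y) ∈ skewBoxes c i r₁ r₂ e c' ∧
        ∀ z ∈ skewBoxes c i r₁ r₂ e c', ¬ skewRel c (x, y) z) ↔
      (((r₂ < r₁ ∧ 2 ≤ r₁) ∧ (x, y) = (c, r₁ - 1) ∨
        (1 ≤ r₂ ∧ (2 ≤ r₂ ∨ e = 0)) ∧ (x, y) = (c + 1, r₂ - 1)) ∨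
        1 ≤ e ∧ (x, y) = (c + 1 + e, 0)) ∨
        (1 ≤ c' ∧ r₁ ≤ i) ∧ (x, y) = (c' - 1, i) := by
  obtain ⟨h₁, h₂₁, he⟩ := h
  simp only [Prod.mk.injEq]
  constructor
  · rintro ⟨hx, hmax⟩
    have hbelow : (x + 1, y) ∉ skewBoxes c i r₁ r₂ e c' :=
      fun h => hmax _ h (Or.inr (Or.inl ⟨rfl, Nat.lt_succ_self x⟩))
    have hright : (x, y + 1) ∉ skewBoxes c i r₁ r₂ e c' :=
      fun h => hmax _ h (Or.inl ⟨rfl, Nat.lt_succ_self y⟩)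
    have hleast : ¬ ((x = c ∧ y = 0) ∧ 1 ≤ c') := by
      rintro ⟨⟨rfl, rfl⟩, h⟩
      exact hmax (0, i) (mem_skewBoxes.2 (by omega))
        (Or.inr (Or.inr ⟨rfl, by rw [Ne, Prod.mk.injEq]; omega⟩))
    rw [mem_skewBoxes] at hx hbelow hright
    rcases hx with hx | hx | hx | hx
    · exact Or.inl (Or.inl (Or.inl (by omega)))
    · exact Or.inl (Or.inl (Or.inr (by omega)))
    · exact Or.inl (Or.inr (by omega))
    · exact Or.inr (by omega)
  · intro h
    refine ⟨mem_skewBoxes.2 (by omega), fun ⟨x', y'⟩ h' hrel => ?_⟩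
    rw [mem_skewBoxes] at h'
    simp only [skewRel, Prod.mk.injEq, ne_eq] at hrel
    rcases h with ((h | h) | h) | h <;> rcases hrel with hrel | hrel | hrel <;>
      rcases h' with h' | h' | h' | h' <;> omega

/-- The number of standard fillings of `skewBoxes` for which `(c, 0)` is the least box. -/
noncomputable def skewCount (c i r₁ r₂ e c' : ℕ) : ℕ :=
  (linearExtensions (skewRel c) (skewBoxes c i r₁ r₂ e c')).ncard

theorem mem_ite_singleton {β : Type*} {p : Prop} [Decidable p] {a x : β} :
    x ∈ (if p then {a} else ∅ : Finset β) ↔ p ∧ x = a := by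
  split_ifs with h <;> simp [h]

theorem sum_ite_singleton {β A : Type*} [AddCommMonoid A] {p : Prop} [Decidable p] (a : β)
    (f : β → A) : ∑ x ∈ (if p then {a} else ∅ : Finset β), f x = if p then f a else 0 := by
  split_ifs <;> simp

theorem skewCount_rec (hi : 1 ≤ i) (h : IsNearHook r₁ r₂ e) (h₁i : r₁ ≤ i + 1)
    (hc : c' ≤ c) (hcc : r₁ = i + 1 → c' = c) (hsize : 2 ≤ r₁ + r₂ + e + c') :
    skewCount c i r₁ r₂ e c' = cornerSum (skewCount c i · · · c') r₁ r₂ e +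
      (if 1 ≤ c' ∧ r₁ ≤ i then skewCount c i r₁ r₂ e (c' - 1) else 0) := by
  classical
  have hmaximal : {x ∈ skewBoxes c i r₁ r₂ e c' |
        ∀ y ∈ skewBoxes c i r₁ r₂ e c', ¬ skewRel c x y} =
      (if r₂ < r₁ ∧ 2 ≤ r₁ then {(c, r₁ - 1)} else ∅) ∪
      (if 1 ≤ r₂ ∧ (2 ≤ r₂ ∨ e = 0) then {(c + 1, r₂ - 1)} else ∅) ∪
      (if 1 ≤ e then {(c + 1 + e, 0)} else ∅) ∪
      (if 1 ≤ c' ∧ r₁ ≤ i then {(c' - 1, i)} else ∅) := by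
    ext ⟨x, y⟩
    simp only [Finset.mem_filter, Finset.mem_union, mem_ite_singleton]
    exact forall_not_skewRel_iff hi h h₁i hc hcc hsize
  have h₁ := h.1
  rw [skewCount, ncard_linearExtensions_eq_sum ⟨(c, 0), mem_skewBoxes.2 (by omega)⟩, hmaximal,
    Finset.sum_union, Finset.sum_union, Finset.sum_union]
  · simp only [sum_ite_singleton, cornerSum, skewCount]
    refine congrArg₂ _ (congrArg₂ _ (congrArg₂ _ ?_ ?_) ?_) ?_ <;>
      refine ite_congr rfl (fun h => ?_) fun _ => rfl
    · rw [skewBoxes_erase_row h₁ hc]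
    · rw [skewBoxes_erase_second_row h.1 hc]
    · rw [skewBoxes_erase_leg h hc]
    · rw [skewBoxes_erase_column h.1 hc]
  all_goals
    simp only [Finset.disjoint_left, Finset.mem_union, mem_ite_singleton, Prod.forall,
      Prod.mk.injEq]
    intro x y h h'
    omega

theorem skewCount_singleton (c i : ℕ) : skewCount c i 1 0 0 0 = 1 := by
  classical
  have hS : skewBoxes c i 1 0 0 0 = {(c, 0)} := by
    ext ⟨x, y⟩
    rw [mem_skewBoxes, Finset.mem_singleton, Prod.mk.injEq]
    omega
  rw [skewCount, hS, ncard_linearExtensions_eq_sum (Finset.singleton_nonempty _),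
    Finset.filter_true_of_mem (by simp [skewRel]), Finset.sum_singleton, Finset.erase_singleton,
    linearExtensions_empty, ncard_singleton]

/-- If column `i` is detached from the near-hook, the only condition that links the two is that
`(c, 0)` be the least box. -/
theorem skewCount_eq_choose_mul_nearHookCount (hi : 1 ≤ i) (h : IsNearHook r₁ r₂ e) (h₁i : r₁ ≤ i)
    (hc : c' ≤ c) :
    (skewCount c i r₁ r₂ e c' : ℚ) =
      (r₁ + r₂ + e + c' - 1).choose c' * nearHookCount r₁ r₂ e := by
  induction hs : r₁ + r₂ + e + c' using Nat.strong_induction_on generalizing r₁ r₂ e c' with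
  | _ s ih
  have h₁ := h.1
  have hcorner : (cornerSum (skewCount c i · · · c') r₁ r₂ e : ℕ) =
      ((s - 2).choose c' * cornerSum nearHookCount r₁ r₂ e : ℚ) := by
    rw [cast_cornerSum, ← cornerSum_const_mul]
    refine cornerSum_congr h fun s₁ s₂ s₃ hs' hs₁ hsize => ?_
    rw [ih _ (by omega) hs' (by omega) hc rfl, show s₁ + s₂ + s₃ + c' - 1 = s - 2 by omega]
  rcases Nat.lt_or_ge (r₁ + r₂ + e) 2 with hbox | hsize
  · obtain ⟨rfl, rfl, rfl⟩ : r₁ = 1 ∧ r₂ = 0 ∧ e = 0 := by omega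
    rcases c' with _ | c'
    · simp [skewCount_singleton, nearHookCount]
    · rw [skewCount_rec hi h (by omega) hc (by omega) (by omega), Nat.cast_add, hcorner,
        if_pos ⟨by omega, h₁i⟩, ih _ (by omega) h h₁i (by omega) rfl]
      simp [cornerSum, ← hs]
  · rw [skewCount_rec hi h (by omega) hc (by omega) (by omega), Nat.cast_add, hcorner,
      cornerSum_nearHookCount h hsize]
    rcases c' with _ | c'
    · simp
    · rw [if_pos ⟨by omega, h₁i⟩, ih _ (by omega) h h₁i (by omega) rfl,
        show r₁ + r₂ + e + (c' + 1 - 1) - 1 = s - 2 by omega, show s - 1 = s - 2 + 1 by omega,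
        Nat.add_sub_cancel, Nat.choose_succ_succ]
      push_cast
      ring

theorem skewCount_eq_skewCount_of_le {d j : ℕ} (hi : 1 ≤ i) (hj : 1 ≤ j) (h : IsNearHook r₁ r₂ e)
    (h₁i : r₁ ≤ i) (h₁j : r₁ ≤ j) (hc : c' ≤ c) (hd : c' ≤ d) :
    skewCount c i r₁ r₂ e c' = skewCount d j r₁ r₂ e c' := by
  exact_mod_cast (skewCount_eq_choose_mul_nearHookCount hi h h₁i hc).trans
    (skewCount_eq_choose_mul_nearHookCount hj h h₁j hd).symm

/-- In a filling of the right-hand shape, where column `i + 1` is detached from row `c + 1` of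
length `i + 1`, compare the last box of the row with the last box of the column. If the former is
larger, the column can be attached to it from above, and otherwise the last box of the column can
be attached to the end of the row. -/
theorem skewCount_add_skewCount (hi : 1 ≤ i) (h : IsNearHook (i + 1) r₂ e) :
    skewCount (c + 1) i (i + 1) r₂ e (c + 1) + skewCount c (i + 1) (i + 2) r₂ e c =
      skewCount (c + 1) (i + 1) (i + 1) r₂ e (c + 1) := by
  induction hs : r₂ + e using Nat.strong_induction_on generalizing r₂ e with
  | _ s ih
  obtain ⟨h₁, h₂₁, he⟩ := h
  have hrow (hr : r₂ ≤ i) :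
      skewCount (c + 1) i i r₂ e (c + 1) = skewCount (c + 1) (i + 1) i r₂ e (c + 1) :=
    skewCount_eq_skewCount_of_le hi h₁ ⟨hi, hr, he⟩ le_rfl (by omega) le_rfl le_rfl
  have hcolumn : skewCount c (i + 1) (i + 1) r₂ e c = skewCount (c + 1) (i + 1) (i + 1) r₂ e c :=
    skewCount_eq_skewCount_of_le h₁ h₁ ⟨h₁, h₂₁, he⟩ le_rfl le_rfl le_rfl (by omega)
  have hsecond (hr : 1 ≤ r₂ ∧ (2 ≤ r₂ ∨ e = 0)) :=
    ih _ (by omega) (r₂ := r₂ - 1) (e := e) ⟨h₁, by omega, by omega⟩ rfl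
  have hleg (he' : 1 ≤ e) := ih _ (by omega) (r₂ := r₂) (e := e - 1) ⟨h₁, h₂₁, by omega⟩ rfl
  rw [skewCount_rec hi ⟨h₁, h₂₁, he⟩ le_rfl le_rfl (by simp) (by omega),
    skewCount_rec (r₁ := i + 2) h₁ ⟨by omega, by omega, he⟩ le_rfl le_rfl (by simp) (by omega),
    skewCount_rec h₁ ⟨h₁, h₂₁, he⟩ (by omega) le_rfl (by simp) (by omega)]
  simp only [cornerSum, Nat.add_sub_cancel, show i + 2 - 1 = i + 1 by omega, hcolumn]
  grind

theorem skewBoxes_no_column (c i j r₁ r₂ e : ℕ) :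
    skewBoxes c i r₁ r₂ e 0 = skewBoxes c j r₁ r₂ e 0 := by
  simp [skewBoxes]

theorem skewCount_eq_sum (hi : 1 ≤ i) (h : IsNearHook (i + 1) r₂ e) :
    (skewCount c i (i + 1) r₂ e c : ℚ) = ∑ j ∈ Finset.range (c + 1),
      (-1) ^ j * nearHookCount (i + 1 + j) r₂ e * (i + r₂ + e + c).choose (c - j) := by
  induction c generalizing i with
  | zero =>
    rw [skewCount, skewBoxes_no_column 0 i (i + 1), ← skewCount,
      skewCount_eq_choose_mul_nearHookCount (by omega) h le_rfl le_rfl]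
    simp
  | succ c ih =>
    have hhook : IsNearHook (i + 2) r₂ e := ⟨by omega, by have := h.2.1; omega, h.2.2⟩
    have hattach : (skewCount (c + 1) i (i + 1) r₂ e (c + 1) +
        skewCount c (i + 1) (i + 2) r₂ e c : ℚ) =
        skewCount (c + 1) (i + 1) (i + 1) r₂ e (c + 1) := by
      exact_mod_cast skewCount_add_skewCount (c := c) hi h
    rw [eq_sub_of_add_eq hattach, ih (by omega) hhook,
      skewCount_eq_choose_mul_nearHookCount (by omega) h le_rfl le_rfl,
      Finset.sum_range_succ' _ (c + 1), sub_eq_neg_add, ← Finset.sum_neg_distrib]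
    refine congrArg₂ _ (Finset.sum_congr rfl fun j _ => ?_) ?_
    · rw [show i + 1 + 1 + j = i + 1 + (j + 1) by ring, Nat.add_sub_add_right,
        show i + 1 + r₂ + e + c = i + r₂ + e + (c + 1) by ring]
      ring
    · rw [show i + 1 + r₂ + e + (c + 1) - 1 = i + r₂ + e + (c + 1) by omega]
      simp [mul_comm]

theorem skytBoxes_eq_skewBoxes {d : ℕ} (hi : 1 ≤ i) :
    skytBoxes (d + 2) i (c + 2) = skewBoxes c i (i + 1) (i + 1) d c := by
  ext ⟨x, y⟩
  rw [mem_skewBoxes]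
  simp only [skytBoxes, Finset.mem_union, Finset.mem_product, Finset.mem_singleton,
    Finset.mem_range, Finset.mem_Ico]
  omega

theorem card_skytBoxes {d : ℕ} (hi : 1 ≤ i) :
    (skytBoxes (d + 2) i (c + 2)).card = d + 2 + 2 * i + (c + 2) - 2 := by
  rw [skytBoxes, Finset.card_union_of_disjoint, Finset.card_union_of_disjoint]
  · simp only [Finset.card_product, Nat.card_Ico, Finset.card_singleton, Finset.card_range,
      Nat.add_sub_cancel, Nat.add_sub_cancel_left]
    omega
  all_goals
    simp only [Finset.disjoint_left, Finset.mem_union, Finset.mem_product, Finset.mem_singleton,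
      Finset.mem_range, Finset.mem_Ico, Prod.forall]
    omega

theorem SkytBar_eq_setOf_skewRel {a b : ℕ} (ha : 1 ≤ a) :
    SkytBar a i b = {T | Function.Bijective T ∧
      ∀ x y : skytBoxes a i b, skewRel (b - 2) x y → T x < T y} := by
  let corner : skytBoxes a i b := ⟨(b - 2, 0), by simp [skytBoxes]; omega⟩
  ext T
  constructor
  · rintro ⟨⟨hT, hrow, hcol⟩, hone⟩
    refine ⟨hT, fun x y hxy => ?_⟩
    rcases hxy with hxy | hxy | ⟨hx, hyx⟩
    · exact hrow x y hxy.1 hxy.2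
    · exact hcol x y hxy.1 hxy.2
    · have hne : T x ≠ T y := fun h => hyx (congrArg Subtype.val (hT.1 h)).symm
      refine lt_of_le_of_ne (Subtype.coe_le_coe.1 ?_) hne
      rw [hone x hx]
      exact (Finset.mem_Icc.1 (T y).2).1
  · rintro ⟨hT, hlt⟩
    refine ⟨⟨hT, fun x y h h' => hlt x y (Or.inl ⟨h, h'⟩),
      fun x y h h' => hlt x y (Or.inr (Or.inl ⟨h, h'⟩))⟩, fun x hx => ?_⟩
    have hcorner := Finset.mem_Icc.1 (T corner).2
    obtain ⟨y, hy⟩ := hT.2 ⟨1, Finset.mem_Icc.2 ⟨le_rfl, hcorner.1.trans hcorner.2⟩⟩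
    have hle : T x ≤ T y := by
      by_cases hyx : y = x
      · rw [hyx]
      · exact (hlt x y (Or.inr (Or.inr ⟨hx, Subtype.coe_ne_coe.2 hyx⟩))).le
    exact le_antisymm (hle.trans_eq hy) (Finset.mem_Icc.1 (T x).2).1

theorem skytBar_eq_skewCount {d : ℕ} (hi : 1 ≤ i) :
    skytBar (d + 2) i (c + 2) = skewCount c i (i + 1) (i + 1) d c := by
  have hbij := bijOn_extend_linearExtensions (skewRel c) (card_skytBoxes (c := c) (d := d) hi)
  rw [skytBar, if_neg (by omega), skewCount, ← skytBoxes_eq_skewBoxes hi,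
    SkytBar_eq_setOf_skewRel (by omega), ← hbij.image_eq, hbij.injOn.ncard_image,
    Nat.add_sub_cancel]

theorem skytBar_pos {a b : ℕ} (ha : 2 ≤ a) (hi : 1 ≤ i) (hb : 2 ≤ b) : 0 < skytBar a i b := by
  obtain ⟨d, rfl⟩ := Nat.exists_eq_add_of_le' ha
  obtain ⟨c, rfl⟩ := Nat.exists_eq_add_of_le' hb
  rw [skytBar_eq_skewCount hi, skewCount, ncard_pos (linearExtensions_finite _ _)]
  refine linearExtensions_nonempty_of_strictMono
    (fun x => if x = (c, 0) then 0 else x.1 + x.2 + 1) ?_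
  rintro ⟨x, y⟩ hxy ⟨x', y'⟩ hxy' hrel
  simp only [skewRel, mem_skewBoxes, ne_eq, Prod.mk.injEq] at hxy hxy' hrel ⊢
  split_ifs <;> omega

end SkewTableaux

section BinomialShift

variable {R : Type*} [CommRing R]

/-- The generalized binomial transform `k ↦ ∑ i, (k + d choose i + d) * s ^ (k - i) * f i` of a
sequence `f`. These operators satisfy the semigroup law `binomialShift_binomialShift` in `s`. -/
def binomialShift (d : ℕ) (s : R) (f : ℕ → R) (k : ℕ) : R :=
  ∑ i ∈ Finset.range (k + 1), (k + d).choose (i + d) * s ^ (k - i) * f i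

theorem binomialShift_binomialShift (d : ℕ) (s t : R) (f : ℕ → R) (k : ℕ) :
    binomialShift d s (binomialShift d t f) k = binomialShift d (s + t) f k := by
  simp only [binomialShift, Finset.mul_sum]
  rw [Finset.sum_comm' (t' := Finset.range (k + 1)) (s' := fun i => Finset.Ico i (k + 1))
    (by simp only [Finset.mem_range, Finset.mem_Ico]; omega)]
  refine Finset.sum_congr rfl fun i hi => ?_
  have hik : i ≤ k := Nat.le_of_lt_succ (Finset.mem_range.1 hi)
  rw [Finset.sum_Ico_eq_sum_range, Nat.sub_add_comm hik, add_comm s t, add_pow, Finset.mul_sum,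
    Finset.sum_mul]
  refine Finset.sum_congr rfl fun j _ => ?_
  have hchoose : ((k + d).choose (i + j + d) * (i + j + d).choose (i + d) : R) =
      (k + d).choose (i + d) * (k - i).choose j := by
    rw [← Nat.cast_mul, Nat.choose_mul (by omega), Nat.add_sub_add_right, Nat.add_sub_add_right,
      Nat.add_sub_cancel_left, Nat.cast_mul]
  rw [Nat.add_sub_cancel_left, ← Nat.sub_sub]
  linear_combination (s ^ (k - i - j) * t ^ j * f i) * hchoose

theorem binomialShift_zero (d : ℕ) (f : ℕ → R) : binomialShift d 0 f = f := by
  ext k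
  rw [binomialShift, Finset.sum_range_succ, Finset.sum_eq_zero fun i hi => ?_]
  · simp
  · rw [zero_pow (Nat.sub_pos_of_lt (Finset.mem_range.1 hi)).ne', mul_zero, zero_mul]

theorem binomialShift_sub (d : ℕ) (s : R) (f g : ℕ → R) :
    binomialShift d s (f - g) = binomialShift d s f - binomialShift d s g := by
  ext k
  simp only [binomialShift, Pi.sub_apply, mul_sub, Finset.sum_sub_distrib]

theorem sum_powerset_eq_binomialShift {α : Type*} {f : ℕ → R} (hf : f 0 = 0) (t : R) {d k : ℕ}
    {S : Finset α} (hS : S.card = k + d) :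
    ∑ A ∈ S.powerset, t ^ A.card * f (k - A.card) = binomialShift d t f k := by
  rw [Finset.sum_powerset_apply_card fun j => t ^ j * f (k - j), hS, ← Finset.sum_range_reflect,
    show k + d + 1 = d + (k + 1) by ring, Finset.sum_range_add, Finset.sum_eq_zero, zero_add,
    binomialShift]
  · refine Finset.sum_congr rfl fun i hi => ?_
    have hik : i ≤ k := Nat.le_of_lt_succ (Finset.mem_range.1 hi)
    rw [show d + (k + 1) - 1 - (d + i) = k - i by omega, Nat.sub_sub_self hik, nsmul_eq_mul,
      Nat.choose_symm_of_eq_add (show k + d = (k - i) + (i + d) by omega), mul_assoc]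
  · intro i hi
    rw [Finset.mem_range] at hi
    rw [show k - (d + (k + 1) - 1 - i) = 0 by omega, hf, mul_zero, smul_zero]

theorem coeff_binomialShift_X (d : ℕ) (p : ℕ → R[X]) (n m : ℕ) :
    (binomialShift d X p (n + m)).coeff m =
      ∑ i ∈ Finset.range (m + 1), ((n + m + d).choose (n + i + d) : R) * (p (n + i)).coeff i := by
  have hterm (l : ℕ) :
      (((n + m + d).choose (l + d) : R[X]) * X ^ (n + m - l) * p l).coeff m =
        (n + m + d).choose (l + d) *
          if n + m - l ≤ m then (p l).coeff (m - (n + m - l)) else 0 := by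
    rw [mul_assoc, ← C_eq_natCast, coeff_C_mul, coeff_X_pow_mul']
  rw [binomialShift, finsetSum_coeff, add_assoc, Finset.sum_range_add, Finset.sum_eq_zero, zero_add]
  · refine Finset.sum_congr rfl fun i hi => ?_
    rw [Finset.mem_range] at hi
    rw [hterm, if_pos (by omega), show m - (n + m - (n + i)) = i by omega]
  · intro l hl
    rw [Finset.mem_range] at hl
    rw [hterm, if_neg (by omega), mul_zero]

theorem natDegree_binomialShift_X_le (d : ℕ) {p : ℕ → R[X]} (hp : ∀ k, (p k).natDegree ≤ k)
    (k : ℕ) : (binomialShift d X p k).natDegree ≤ k := by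
  refine natDegree_sum_le_of_forall_le _ _ fun i hi => ?_
  refine (natDegree_mul_le_of_le (m := k - i) (n := i) ?_ (hp i)).trans ?_
  · rw [← C_eq_natCast]
    exact natDegree_C_mul_X_pow_le _ _
  · rw [Finset.mem_range] at hi
    omega

theorem reflect_sum {ι : Type*} (s : Finset ι) (f : ι → R[X]) (N : ℕ) :
    reflect N (∑ i ∈ s, f i) = ∑ i ∈ s, reflect N (f i) := by
  ext i
  simp only [coeff_reflect, finsetSum_coeff]

theorem reflect_binomialShift_X (d : ℕ) {p : ℕ → R[X]} (hp : ∀ k, (p k).natDegree ≤ k) (k : ℕ) :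
    reflect k (binomialShift d X p k) = binomialShift d 1 (fun l => reflect l (p l)) k := by
  rw [binomialShift, reflect_sum]
  refine Finset.sum_congr rfl fun i hi => ?_
  have hik : i ≤ k := Nat.le_of_lt_succ (Finset.mem_range.1 hi)
  have hmul := reflect_mul (X ^ (k - i)) (p i) (natDegree_X_pow_le _) (hp i)
  rw [Nat.sub_add_cancel hik, reflect_monomial, revAt_le le_rfl, Nat.sub_self, pow_zero,
    one_mul] at hmul
  rw [mul_assoc, ← C_eq_natCast, reflect_C_mul, hmul, one_pow, mul_one]

theorem binomialShift_X_sub_one_sub_of_reflect {d : ℕ} {p δ : ℕ → R[X]}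
    (hp : ∀ k, (p k).natDegree ≤ k)
    (h : ∀ k, binomialShift d X p k - δ k = reflect k (binomialShift d X p k)) (k : ℕ) :
    binomialShift d (X - 1) p k - binomialShift d (-1) δ k = reflect k (p k) := by
  -- `reflect` conjugates `binomialShift d X` to `binomialShift d 1`, whose inverse is
  -- `binomialShift d (-1)`.
  have hfun : binomialShift d X p - δ = binomialShift d 1 fun l => reflect l (p l) :=
    funext fun l => (h l).trans (reflect_binomialShift_X d hp l)
  rw [sub_eq_neg_add X, ← binomialShift_binomialShift d (-1) X,
    ← Pi.sub_apply (binomialShift d (-1) _), ← binomialShift_sub, hfun,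
    binomialShift_binomialShift, neg_add_cancel, binomialShift_zero]

end BinomialShift

section RelaxCoeff

theorem sum_neg_one_pow_mul_choose_div (m d : ℕ) :
    ∑ i ∈ Finset.range (m + 1), (-1) ^ i * (m.choose i : ℚ) / (i + d + 1) =
      m.factorial * d.factorial / (m + d + 1).factorial := by
  induction m generalizing d with
  | zero =>
    simp only [zero_add, Finset.sum_range_one, pow_zero, Nat.choose_self, Nat.cast_one, mul_one,
      Nat.cast_zero, Nat.factorial_zero, one_mul, Nat.factorial_succ, Nat.cast_mul, Nat.cast_add]
    field_simp
  | succ m ih =>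
    have hpascal : ∑ i ∈ Finset.range (m + 2), (-1) ^ i * ((m + 1).choose i : ℚ) / (i + d + 1) =
        ∑ i ∈ Finset.range (m + 1), (-1) ^ i * (m.choose i : ℚ) / (i + d + 1) -
        ∑ i ∈ Finset.range (m + 1), (-1) ^ i * (m.choose i : ℚ) / (i + (d + 1 : ℕ) + 1) := by
      have hextend : ∑ i ∈ Finset.range (m + 1), (-1) ^ i * (m.choose i : ℚ) / (i + d + 1) =
          ∑ i ∈ Finset.range (m + 2), (-1) ^ i * (m.choose i : ℚ) / (i + d + 1) := by
        rw [Finset.sum_range_succ _ (m + 1), Nat.choose_succ_self, Nat.cast_zero, mul_zero,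
          zero_div, add_zero]
      rw [hextend, Finset.sum_range_succ', Finset.sum_range_succ' _ (m + 1), add_sub_right_comm,
        ← Finset.sum_sub_distrib]
      congr 1
      · refine Finset.sum_congr rfl fun i _ => ?_
        rw [Nat.choose_succ_succ]
        push_cast
        rw [show (i + 1 + d + 1 : ℚ) = i + (d + 1) + 1 by ring]
        ring
      · simp
    rw [hpascal, ih, ih, show m + (d + 1) + 1 = m + d + 1 + 1 by ring,
      show m + 1 + d + 1 = m + d + 1 + 1 by ring, Nat.factorial_succ (m + d + 1),
      Nat.factorial_succ m, Nat.factorial_succ d]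
    push_cast
    field_simp
    ring

theorem sum_neg_one_pow_mul_choose_mul_self (n : ℕ) :
    ∑ i ∈ Finset.range (n + 1), (-1) ^ i * (n.choose i : ℤ) * i = if n = 1 then -1 else 0 := by
  rcases n with _ | n
  · simp
  have habsorb (i : ℕ) : (-1) ^ (i + 1) * ((n + 1).choose (i + 1) : ℤ) * (i + 1 : ℕ) =
      -(n + 1) * ((-1) ^ i * n.choose i) := by
    have h : ((n + 1) * n.choose i : ℤ) = (n + 1).choose (i + 1) * (i + 1) := by
      exact_mod_cast Nat.add_one_mul_choose_eq n i
    push_cast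
    rw [pow_succ]
    linear_combination (-1) ^ i * h
  rw [Finset.sum_range_succ']
  simp only [habsorb]
  rw [← Finset.mul_sum, Int.alternating_sum_range_choose]
  by_cases hn : n = 0 <;> simp [hn]

/-- The weight of the pair `(x, y)` in the closed form `relaxCoeff` of the numbers of restricted
skew tableaux. -/
def skytWeight (d x y : ℕ) : ℚ :=
  (-1) ^ (x + y + 1) * (x / (y + d + 1) - y / (x + d + 1))

theorem skytWeight_swap (d x y : ℕ) : skytWeight d x y = -skytWeight d y x := by
  rw [skytWeight, skytWeight, add_comm y x]
  ring

theorem sum_sum_skytWeight_mul_choose (d n m : ℕ) :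
    ∑ i ∈ Finset.range (m + 1), ∑ x ∈ Finset.range (n + 1),
      skytWeight d x i * n.choose x * m.choose i =
    (if n = 1 then 1 else 0) * (m.factorial * d.factorial / (m + d + 1).factorial : ℚ) -
      (if m = 1 then 1 else 0) * (n.factorial * d.factorial / (n + d + 1).factorial) := by
  have hself (r : ℕ) : ∑ i ∈ Finset.range (r + 1), (-1) ^ i * (r.choose i : ℚ) * i =
      -if r = 1 then 1 else 0 := by
    have h := congrArg (Int.cast : ℤ → ℚ) (sum_neg_one_pow_mul_choose_mul_self r)
    push_cast at h
    rw [h, neg_ite, neg_zero]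
  have hweight (i x : ℕ) : skytWeight d x i * n.choose x * m.choose i =
      (-1) ^ x * n.choose x / (x + d + 1) * ((-1) ^ i * m.choose i * i) -
      (-1) ^ x * n.choose x * x * ((-1) ^ i * m.choose i / (i + d + 1)) := by
    rw [skytWeight]
    ring
  simp only [hweight, Finset.sum_sub_distrib, ← Finset.sum_mul, ← Finset.mul_sum, hself,
    sum_neg_one_pow_mul_choose_div]
  ring

theorem sum_sum_Ico_add_sum_sum_Ico {A : Type*} [AddCommMonoid A] {f : ℕ → ℕ → A}
    (hf : ∀ i, f i i = 0) (m n : ℕ) :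
    ∑ i ∈ Finset.range m, ∑ x ∈ Finset.Ico (i + 1) n, f i x +
      ∑ x ∈ Finset.range n, ∑ i ∈ Finset.Ico (x + 1) m, f i x =
    ∑ i ∈ Finset.range m, ∑ x ∈ Finset.range n, f i x := by
  have hswap : ∑ x ∈ Finset.range n, ∑ i ∈ Finset.Ico (x + 1) m, f i x =
      ∑ i ∈ Finset.range m, ∑ x ∈ Finset.range n with x < i, f i x :=
    Finset.sum_comm' (by simp only [Finset.mem_range, Finset.mem_Ico, Finset.mem_filter]; omega)
  rw [hswap, ← Finset.sum_add_distrib]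
  refine Finset.sum_congr rfl fun i _ => ?_
  rw [← Finset.sum_filter_add_sum_filter_not (Finset.range n) (· < i), add_comm]
  congr 1
  refine Finset.sum_subset (fun x => ?_) fun x hx hx' => ?_
  · simp only [Finset.mem_Ico, Finset.mem_filter, Finset.mem_range]
    omega
  · simp only [Finset.mem_Ico, Finset.mem_filter, Finset.mem_range] at hx hx'
    rw [show x = i by omega, hf]

/-- The coefficient of `t ^ i` in the relaxation polynomial for rank `n + i` and hyperplanes of
cardinality `n + i + d`, in closed form. -/
def relaxCoeff (d n i : ℕ) : ℚ :=
  (n + i + d).factorial / (d.factorial * n.factorial * i.factorial) *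
    ∑ x ∈ Finset.Ico (i + 1) (n + 1), skytWeight d x i * n.choose x

theorem relaxCoeff_eq_zero {d n i : ℕ} (h : n ≤ i) : relaxCoeff d n i = 0 := by
  rw [relaxCoeff, Finset.Ico_eq_empty (by omega), Finset.sum_empty, mul_zero]

theorem relaxCoeff_zero_right (d n : ℕ) : relaxCoeff d n 0 = if n = 1 then 1 else 0 := by
  have hsum : ∑ x ∈ Finset.Ico (0 + 1) (n + 1), skytWeight d x 0 * n.choose x =
      if n = 1 then 1 / (d + 1 : ℚ) else 0 := by
    have h := congrArg (Int.cast : ℤ → ℚ) (sum_neg_one_pow_mul_choose_mul_self n)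
    rw [Finset.range_eq_Ico, Finset.sum_eq_sum_Ico_succ_bot (Nat.succ_pos n)] at h
    push_cast at h
    rw [mul_zero, zero_add] at h
    rw [show (if n = 1 then 1 / (d + 1 : ℚ) else 0) = -(1 / (d + 1)) * if n = 1 then -1 else 0 by
      split_ifs <;> ring, ← h, Finset.mul_sum]
    refine Finset.sum_congr rfl fun x _ => ?_
    rw [skytWeight]
    push_cast
    ring
  rw [relaxCoeff, hsum]
  split_ifs with h
  · rw [h, show 1 + 0 + d = d + 1 by ring, Nat.factorial_succ]
    push_cast
    field_simp
    simp
  · rw [mul_zero]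

theorem skytBar_eq_relaxCoeff {d n i : ℕ} (hi : 1 ≤ i) (h : i < n) :
    (skytBar (d + 2) i (n - i + 1) : ℚ) = relaxCoeff d n i := by
  obtain ⟨c, rfl⟩ : ∃ c, n = i + 1 + c := ⟨n - (i + 1), by omega⟩
  rw [show i + 1 + c - i + 1 = c + 2 by omega, skytBar_eq_skewCount hi,
    skewCount_eq_sum hi ⟨by omega, le_rfl, by omega⟩, relaxCoeff, Finset.mul_sum,
    Finset.sum_Ico_eq_sum_range, show i + 1 + c + 1 - (i + 1) = c + 1 by omega]
  refine Finset.sum_congr rfl fun j hj => ?_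
  rw [Finset.mem_range] at hj
  rw [nearHookCount_eq (by omega), skytWeight,
    Nat.cast_choose ℚ (show i + 1 + j ≤ i + 1 + c by omega),
    Nat.cast_choose ℚ (show c - j ≤ i + (i + 1) + d + c by omega),
    show i + 1 + c - (i + 1 + j) = c - j by omega,
    show i + (i + 1) + d + c - (c - j) = i + j + i + 1 + d by omega,
    show i + 1 + j + (i + 1) + d = (i + j + i + 1 + d) + 1 by ring,
    show i + (i + 1) + d + c = i + 1 + c + i + d by ring, Nat.factorial_succ (i + j + i + 1 + d),
    show i + 1 + j + i + 1 = 2 * (i + 1) + j by ring, pow_add, pow_mul, Nat.factorial_succ i]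
  push_cast
  field_simp
  ring

theorem sum_choose_mul_relaxCoeff (d n m : ℕ) :
    ∑ i ∈ Finset.range (m + 1), ((n + m + d).choose (n + i + d) : ℚ) * relaxCoeff d n i =
      (n + m + d).factorial / (d.factorial * n.factorial * m.factorial) *
        ∑ i ∈ Finset.range (m + 1), ∑ x ∈ Finset.Ico (i + 1) (n + 1),
          skytWeight d x i * n.choose x * m.choose i := by
  rw [Finset.mul_sum]
  refine Finset.sum_congr rfl fun i hi => ?_
  have him : i ≤ m := Nat.le_of_lt_succ (Finset.mem_range.1 hi)
  rw [← Finset.sum_mul, relaxCoeff, Nat.cast_choose ℚ (show n + i + d ≤ n + m + d by omega),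
    Nat.cast_choose ℚ him, show n + m + d - (n + i + d) = m - i by omega]
  field_simp

theorem sum_choose_mul_relaxCoeff_sub (d n m : ℕ) :
    ∑ i ∈ Finset.range (m + 1), ((n + m + d).choose (n + i + d) : ℚ) * relaxCoeff d n i -
      ∑ i ∈ Finset.range (n + 1), ((m + n + d).choose (m + i + d) : ℚ) * relaxCoeff d m i =
    (if n = 1 then 1 else 0) - (if m = 1 then 1 else 0) := by
  have hanti : ∑ i ∈ Finset.range (m + 1), ∑ x ∈ Finset.Ico (i + 1) (n + 1),
        skytWeight d x i * n.choose x * m.choose i -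
      ∑ x ∈ Finset.range (n + 1), ∑ i ∈ Finset.Ico (x + 1) (m + 1),
        skytWeight d i x * m.choose i * n.choose x =
      ∑ i ∈ Finset.range (m + 1), ∑ x ∈ Finset.range (n + 1),
        skytWeight d x i * n.choose x * m.choose i := by
    rw [← sum_sum_Ico_add_sum_sum_Ico (fun i => by rw [skytWeight, sub_self, mul_zero, zero_mul,
      zero_mul]), sub_eq_add_neg]
    simp only [← Finset.sum_neg_distrib]
    refine congrArg _ (Finset.sum_congr rfl fun x _ => Finset.sum_congr rfl fun i _ => ?_)
    rw [skytWeight_swap d x i]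
    ring
  rw [sum_choose_mul_relaxCoeff, sum_choose_mul_relaxCoeff, add_comm m n,
    mul_right_comm _ (m.factorial : ℚ), ← mul_sub, hanti, sum_sum_skytWeight_mul_choose]
  have hone {a b : ℕ} (hb : b = 1) : ((b + a + d).factorial /
      (d.factorial * b.factorial * a.factorial) * (a.factorial * d.factorial /
        (a + d + 1).factorial) : ℚ) = 1 := by
    rw [hb, show 1 + a + d = a + d + 1 by ring, Nat.factorial_one]
    field_simp
    simp
  by_cases hn : n = 1 <;> by_cases hm : m = 1
  · rw [hn, hm, sub_self, sub_self, mul_zero]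
  · rw [if_pos hn, if_neg hm, zero_mul, sub_zero, sub_zero, one_mul, hone hn]
  · rw [if_neg hn, if_pos hm, zero_mul, zero_sub, zero_sub, one_mul, mul_neg, add_comm n m,
      mul_right_comm, hone hm]
  · rw [if_neg hn, if_neg hm, zero_mul, zero_mul, sub_self, mul_zero]

end RelaxCoeff

section RelaxPoly

/-- The polynomial `p_{k, k + d}` that the relaxation of a stressed hyperplane with `k + d` elements
adds to the Kazhdan–Lusztig polynomial of a matroid of rank `k`. -/
noncomputable def relaxPoly (d k : ℕ) : ℤ[X] :=
  if k = 1 then 1 else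
    ∑ i ∈ Finset.range ((k - 1) / 2 + 1), C (skytBar (d + 2) i (k + 1 - 2 * i) : ℤ) * X ^ i

/-- The change of the characteristic polynomial of a matroid of rank `k` that is relaxed at `H`,
minus the characteristic polynomial of the restriction to `H`, is `-binomialShift d (-1) defect k`
if `H` has `k + d` elements; see `charPoly_relax`. -/
noncomputable def defect (k : ℕ) : ℤ[X] := if k = 0 then 0 else X ^ (k - 1) - X

variable {d k i : ℕ}

theorem skytBar_zero (a b : ℕ) : skytBar a 0 b = 0 := if_pos (Or.inl rfl)

theorem coeff_relaxPoly (hk : k ≠ 1) : (relaxPoly d k).coeff i =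
    if i ∈ Finset.range ((k - 1) / 2 + 1) then (skytBar (d + 2) i (k + 1 - 2 * i) : ℤ) else 0 := by
  rw [relaxPoly, if_neg hk, finsetSum_coeff]
  simp only [coeff_C_mul_X_pow]
  rw [Finset.sum_ite_eq]

theorem coeff_relaxPoly_eq_zero (h : k ≤ 2 * i) : (relaxPoly d k).coeff i = 0 := by
  by_cases hk : k = 1
  · rw [relaxPoly, if_pos hk, coeff_one, if_neg (by omega)]
  rw [coeff_relaxPoly hk]
  split_ifs with hi
  · rw [Finset.mem_range] at hi
    rw [show i = 0 by omega, skytBar_zero, Nat.cast_zero]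
  · rfl

theorem coeff_relaxPoly_nonneg : 0 ≤ (relaxPoly d k).coeff i := by
  by_cases hk : k = 1
  · rw [relaxPoly, if_pos hk, coeff_one]
    split_ifs <;> simp
  · rw [coeff_relaxPoly hk]
    split_ifs <;> simp

theorem relaxPoly_zero (d : ℕ) : relaxPoly d 0 = 0 := by
  ext i
  rw [coeff_relaxPoly_eq_zero (Nat.zero_le _), coeff_zero]

theorem relaxPoly_two (d : ℕ) : relaxPoly d 2 = 0 := by
  simp [relaxPoly, skytBar_zero]

theorem degree_relaxPoly (hk : 1 ≤ k) (hk2 : k ≠ 2) :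
    (relaxPoly d k).degree = ((k - 1) / 2 : ℕ) := by
  by_cases h1 : k = 1
  · rw [relaxPoly, if_pos h1, degree_one, h1]
    rfl
  refine le_antisymm ?_ (le_degree_of_ne_zero ?_)
  · rw [degree_le_iff_coeff_zero]
    intro m hm
    have hm' : (k - 1) / 2 < m := by exact_mod_cast hm
    exact coeff_relaxPoly_eq_zero (by omega)
  · rw [coeff_relaxPoly h1, if_pos (Finset.self_mem_range_succ _)]
    exact_mod_cast (skytBar_pos (Nat.le_add_left 2 d) (by omega) (by omega)).ne'

theorem natDegree_relaxPoly_le (d k : ℕ) : (relaxPoly d k).natDegree ≤ k :=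
  natDegree_le_iff_coeff_eq_zero.2 fun _ hi => coeff_relaxPoly_eq_zero (by omega)

theorem cast_coeff_relaxPoly (d n i : ℕ) :
    ((relaxPoly d (n + i)).coeff i : ℚ) = relaxCoeff d n i := by
  rcases Nat.lt_or_ge i n with hin | hni
  · by_cases hk : n + i = 1
    · obtain ⟨rfl, rfl⟩ : n = 1 ∧ i = 0 := by omega
      rw [relaxPoly, if_pos rfl, coeff_one_zero, relaxCoeff_zero_right, if_pos rfl, Int.cast_one]
    rw [coeff_relaxPoly hk, if_pos (by rw [Finset.mem_range]; omega), Int.cast_natCast]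
    rcases Nat.eq_zero_or_pos i with rfl | hi
    · rw [skytBar_zero, relaxCoeff_zero_right, if_neg (by omega), Nat.cast_zero]
    · rw [← skytBar_eq_relaxCoeff hi hin, show n + i + 1 - 2 * i = n - i + 1 by omega]
  · rw [coeff_relaxPoly_eq_zero (by omega), relaxCoeff_eq_zero hni, Int.cast_zero]

theorem binomialShift_X_relaxPoly_sub_defect (d k : ℕ) :
    binomialShift d X (relaxPoly d) k - defect k =
      reflect k (binomialShift d X (relaxPoly d) k) := by
  rcases Nat.eq_zero_or_pos k with rfl | hk
  · simp [binomialShift, relaxPoly_zero, defect]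
  ext m
  rw [coeff_sub, coeff_reflect, defect, if_neg hk.ne', coeff_sub, coeff_X_pow, coeff_X]
  rcases Nat.lt_or_ge k m with hm | hm
  · have hdeg := (natDegree_binomialShift_X_le d (natDegree_relaxPoly_le d) k).trans_lt hm
    rw [revAt_eq_self_of_lt hm, coeff_eq_zero_of_natDegree_lt hdeg, if_neg (by omega),
      if_neg (by omega), sub_self, sub_self]
  obtain ⟨n, rfl⟩ := Nat.exists_eq_add_of_le' hm
  rw [revAt_le hm, Nat.add_sub_cancel, coeff_binomialShift_X, add_comm n m, coeff_binomialShift_X,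
    sub_eq_iff_eq_add', ← sub_eq_iff_eq_add]
  simp only [show m = m + n - 1 ↔ n = 1 by omega, eq_comm (a := 1) (b := m)]
  have h := sum_choose_mul_relaxCoeff_sub d n m
  simp only [← cast_coeff_relaxPoly] at h
  rw [add_comm n m] at h
  exact_mod_cast h

theorem binomialShift_relaxPoly_sub_binomialShift_defect (d k : ℕ) :
    binomialShift d (X - 1) (relaxPoly d) k - binomialShift d (-1) defect k =
      reflect k (relaxPoly d k) :=
  binomialShift_X_sub_one_sub_of_reflect (natDegree_relaxPoly_le d)
    (binomialShift_X_relaxPoly_sub_defect d) k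

end RelaxPoly

section Contract

variable {α : Type*} {M : Matroid α} {A F H : Set α}

theorem eRk_contract_add_encard (hF : M.Indep F) (hA : A ⊆ M.E \ F) :
    (M ／ F).eRk A + F.encard = M.eRk (A ∪ F) := by
  obtain ⟨J, hJ⟩ := (M ／ F).exists_isBasis A hA
  rw [← hJ.encard_eq_eRk, ← (hF.union_isBasis_union_of_contract_isBasis hJ).encard_eq_eRk,
    encard_union_eq (disjoint_of_subset_left hJ.subset (subset_sdiff.1 hA).2)]

theorem eRank_contract_add_encard (hF : M.Indep F) :
    (M ／ F).eRank + F.encard = M.eRank := by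
  rw [← eRk_ground, contract_ground, eRk_contract_add_encard hF Subset.rfl,
    sdiff_union_of_subset hF.subset_ground, eRk_ground]

theorem ssubset_ground_of_isHyperplane [M.RankFinite] (hH : M.IsHyperplane H) : H ⊂ M.E := by
  refine hH.1.subset_ground.ssubset_of_ne ?_
  rintro rfl
  have hrank := hH.2
  rw [eRk_ground] at hrank
  exact ((ENat.lt_add_one_iff ((eRank_ne_top_iff M).2 inferInstance)).2 le_rfl).ne hrank.symm

theorem isNonloop_of_notMem_isFlat (hF : M.IsFlat F) {e : α} (he : e ∈ M.E) (heF : e ∉ F) :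
    M.IsNonloop e :=
  (not_isLoop_iff he).1 fun h => heF (hF.loops_subset h)

theorem eRank_contract_of_isHyperplane [M.RankFinite] (hH : M.IsHyperplane H) :
    (M ／ H).eRank = 1 := by
  refine le_antisymm ?_ ?_
  · obtain ⟨J, hJ⟩ := (M ／ H).exists_isBase
    obtain ⟨I, hI⟩ := M.exists_isBasis H hH.1.subset_ground
    obtain ⟨hJI, hdisj⟩ := hI.contract_indep_iff.1 hJ.indep
    have hcard := hJI.encard_le_eRank
    rw [encard_union_eq (disjoint_of_subset_right hI.subset hdisj.symm), hI.encard_eq_eRk,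
      ← hH.2, add_comm] at hcard
    rw [← hJ.encard_eq_eRank]
    exact (ENat.add_le_add_iff_left (M.isRkFinite_set H).eRk_lt_top.ne).1 hcard
  · obtain ⟨e, heE, heH⟩ := exists_of_ssubset (ssubset_ground_of_isHyperplane hH)
    have he : (M ／ H).IsNonloop e := by
      rwa [contract_isNonloop_iff, hH.1.closure, mem_sdiff, and_iff_right heE]
    rw [← he.eRk_eq]
    exact eRk_le_eRank _ _

end Contract

section Stressed

variable {α : Type*} {M : Matroid α} {A F H : Set α}

theorem indep_of_subset_stressedHyperplane (hH : M.IsStressedHyperplane H)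
    (hle : M.eRank ≤ H.encard) (hA : A ⊆ H) (hlt : A.encard < M.eRank) : M.Indep A := by
  obtain ⟨S, hAS, hSH, hS⟩ := exists_superset_subset_encard_eq hA hlt.le hle
  refine (hH.2 S hSH hS).ssubset_indep (hAS.ssubset_of_ne ?_)
  rintro rfl
  exact hlt.ne hS

theorem eRk_of_subset_stressedHyperplane (hH : M.IsStressedHyperplane H) (hA : A ⊆ H)
    (hle : M.eRank ≤ A.encard) : M.eRk A = M.eRk H := by
  obtain ⟨S, hSA, hS⟩ := exists_subset_encard_eq hle
  have hSr := (hH.2 S (hSA.trans hA) hS).eRk_add_one_eq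
  rw [hS, ← hH.1.2] at hSr
  have hSH : M.eRk S = M.eRk H := ENat.add_left_injective_of_ne_top ENat.one_ne_top hSr
  exact le_antisymm (M.eRk_mono hA) (hSH ▸ M.eRk_mono hSA)

theorem closure_of_subset_stressedHyperplane [M.RankFinite] (hH : M.IsStressedHyperplane H)
    (hA : A ⊆ H) (hle : M.eRank ≤ A.encard) : M.closure A = H := by
  rw [(M.isRkFinite_set A).closure_eq_closure_of_subset_of_eRk_ge_eRk hA
    (eRk_of_subset_stressedHyperplane hH hA hle).ge, hH.1.1.closure]

theorem isStressedHyperplane_contract (hH : M.IsStressedHyperplane H) (hF : F ⊆ H)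
    (hle : M.eRank ≤ H.encard) (hlt : F.encard < M.eRank) :
    (M ／ F).IsStressedHyperplane (H \ F) := by
  have hFi := indep_of_subset_stressedHyperplane hH hle hF hlt
  have hrank := eRank_contract_add_encard hFi
  refine ⟨⟨?_, ?_⟩, fun S hS hSr => ?_⟩
  · rw [isFlat_iff_closure_eq, contract_closure_eq, sdiff_union_of_subset hF, hH.1.1.closure]
  · have hrankH :=
      eRk_contract_add_encard hFi (sdiff_subset_sdiff_left hH.1.1.subset_ground : H \ F ⊆ _)
    rw [sdiff_union_of_subset hF] at hrankH
    refine ENat.add_left_injective_of_ne_top hlt.ne_top ?_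
    simp only [hrank, ← hH.1.2, ← hrankH]
    ring
  · obtain ⟨hSH, hSF⟩ := subset_sdiff.1 hS
    have hcard : (S ∪ F).encard = M.eRank := by rw [encard_union_eq hSF, hSr, hrank]
    have hSne : S.Nonempty := by
      rw [nonempty_iff_ne_empty]
      rintro rfl
      rw [empty_union] at hcard
      exact hlt.ne hcard
    have hC := (hH.2 _ (union_subset hSH hF) hcard).contract_sdiff_isCircuit hSne
      subset_union_left
    rwa [union_sdiff_left, hSF.symm.sdiff_eq_left] at hC

end Stressed

section Relax

variable {α : Type*} {M : Matroid α} [M.Finite] {A F H : Set α} (hH : M.IsStressedHyperplane H)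

theorem relax_isBase_iff {B : Set α} :
    (M.relax H hH).IsBase B ↔ M.IsBase B ∨ (B ⊆ H ∧ B.encard = M.eRank) := Iff.rfl

theorem relax_indep_iff {I : Set α} :
    (M.relax H hH).Indep I ↔ M.Indep I ∨ (I ⊆ H ∧ I.encard = M.eRank) := by
  rw [indep_iff]
  constructor
  · rintro ⟨B, hB | hB, hIB⟩
    · exact Or.inl (hB.indep.subset hIB)
    · rcases eq_or_ne I B with rfl | hne
      · exact Or.inr hB
      · exact Or.inl ((hH.2 B hB.1 hB.2).ssubset_indep (hIB.ssubset_of_ne hne))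
  · rintro (hI | hI)
    · obtain ⟨B, hB, hIB⟩ := hI.exists_isBase_superset
      exact ⟨B, Or.inl hB, hIB⟩
    · exact ⟨I, Or.inr hI, Subset.rfl⟩

theorem relax_indep_iff_of_not_subset {I : Set α} (hI : ¬ I ⊆ H) :
    (M.relax H hH).Indep I ↔ M.Indep I := by
  rw [relax_indep_iff, or_iff_left fun h => hI h.1]

theorem relax_eRank : (M.relax H hH).eRank = M.eRank := by
  obtain ⟨B, hB⟩ := M.exists_isBase
  rw [← hB.encard_eq_eRank, ((relax_isBase_iff hH).2 (Or.inl hB)).encard_eq_eRank]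

theorem relax_eq_self (hlt : H.encard < M.eRank) : M.relax H hH = M := by
  refine ext_isBase rfl fun B _ => ?_
  rw [relax_isBase_iff, or_iff_left]
  rintro ⟨hBH, hB⟩
  exact hlt.not_ge (hB ▸ encard_le_encard hBH)

theorem eRk_le_relax_eRk (A : Set α) : M.eRk A ≤ (M.relax H hH).eRk A := by
  rw [eRk_le_iff]
  exact fun I hIA hI => ((relax_indep_iff hH).2 (Or.inl hI)).encard_le_eRk_of_subset hIA

theorem relax_eRk_of_le_encard (hA : A ⊆ H) (hle : M.eRank ≤ A.encard) :
    (M.relax H hH).eRk A = M.eRank := by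
  refine le_antisymm ((eRk_le_eRank _ _).trans (relax_eRank hH).le) ?_
  obtain ⟨S, hSA, hS⟩ := exists_subset_encard_eq hle
  rw [← hS]
  exact ((relax_indep_iff hH).2 (Or.inr ⟨hSA.trans hA, hS⟩)).encard_le_eRk_of_subset hSA

theorem relax_eRk_eq (hAE : A ⊆ M.E) (h : A ⊆ H → A.encard < M.eRank) :
    (M.relax H hH).eRk A = M.eRk A := by
  refine le_antisymm (eRk_le_iff.2 fun I hIA hI => ?_) (eRk_le_relax_eRk hH A)
  rcases (relax_indep_iff hH).1 hI with hI | ⟨hIH, hI⟩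
  · exact hI.encard_le_eRk_of_subset hIA
  · obtain ⟨e, heA, heH⟩ : ∃ e ∈ A, e ∉ H :=
      not_subset.1 fun hAH => (h hAH).not_ge (hI ▸ encard_le_encard hIA)
    have hrank := M.eRk_insert_eq_add_one (X := I) (e := e)
      ⟨hAE heA, by rwa [closure_of_subset_stressedHyperplane hH hIH hI.ge]⟩
    rw [eRk_of_subset_stressedHyperplane hH hIH hI.ge, hH.1.2] at hrank
    rw [hI, ← hrank]
    exact M.eRk_mono (insert_subset heA hIA)

theorem relax_restrict_eq (hAE : A ⊆ M.E) (hAH : ¬ A ⊆ H) (hr : M.eRk A < M.eRank) :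
    M.relax H hH ↾ A = M ↾ A := by
  refine ext_indep rfl fun I (hI : I ⊆ A) => ?_
  rw [restrict_indep_iff, restrict_indep_iff, relax_indep_iff, or_iff_left]
  rintro ⟨hIH, hIr⟩
  have hle := ((relax_indep_iff hH).2 (Or.inr ⟨hIH, hIr⟩)).encard_le_eRk_of_subset hI
  rw [relax_eRk_eq hH hAE (fun h => absurd h hAH), hIr] at hle
  exact hr.not_ge hle

theorem relax_contract_eq (hAE : A ⊆ M.E) (hAH : ¬ A ⊆ H) :
    M.relax H hH ／ A = M ／ A := by
  obtain ⟨e, heA, heH⟩ := not_subset.1 hAH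
  obtain ⟨I, hI, heI⟩ := (isNonloop_of_notMem_isFlat hH.1.1 (hAE heA) heH).indep
    |>.subset_isBasis_of_subset (singleton_subset_iff.2 heA) hAE
  have hindep : ∀ J, I ⊆ J → ((M.relax H hH).Indep J ↔ M.Indep J) := fun J hIJ =>
    relax_indep_iff_of_not_subset hH fun h => heH (h (hIJ (singleton_subset_iff.1 heI)))
  have hI' : (M.relax H hH).IsBasis I A := by
    rw [isBasis_iff_indep_encard_eq_of_finite (M := M.relax H hH)
      (M.ground_finite.subset hI.indep.subset_ground) hAE, hindep I Subset.rfl,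
      relax_eRk_eq hH hAE (fun h => absurd h hAH)]
    exact ⟨hI.subset, hI.indep, hI.encard_eq_eRk⟩
  refine ext_indep rfl fun J _ => ?_
  rw [hI.contract_indep_iff, hI'.contract_indep_iff, hindep _ subset_union_right]

theorem relax_contract_eq_relax (hF : F ⊆ H) (hle : M.eRank ≤ H.encard)
    (hlt : F.encard < M.eRank) :
    M.relax H hH ／ F =
      (M ／ F).relax (H \ F) (isStressedHyperplane_contract hH hF hle hlt) := by
  have hFi := indep_of_subset_stressedHyperplane hH hle hF hlt
  have hFi' : (M.relax H hH).Indep F := (relax_indep_iff hH).2 (Or.inl hFi)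
  refine ext_indep rfl fun J hJ => ?_
  rw [contract_ground, subset_sdiff] at hJ
  rw [hFi'.contract_indep_iff, relax_indep_iff, relax_indep_iff, hFi.contract_indep_iff,
    and_iff_right hJ.2, and_iff_right hJ.2, union_subset_iff, subset_sdiff, and_iff_left hF,
    and_iff_left hJ.2, encard_union_eq hJ.2, ← eRank_contract_add_encard hFi,
    (ENat.add_left_injective_of_ne_top hlt.ne_top).eq_iff]

end Relax

section PowersetSums

variable {α : Type*} {S : Set α}

theorem sum_powerset_ncard {R : Type*} [AddCommMonoid R] (hS : S.Finite) (f : ℕ → R) :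
    ∑ A ∈ hS.powerset.toFinset, f A.ncard = ∑ A ∈ hS.toFinset.powerset, f A.card := by
  refine (Finset.sum_nbij (fun A : Finset α => (A : Set α)) (fun A hA => ?_)
    Finset.coe_injective.injOn (fun A hA => ?_) fun A _ => by rw [ncard_coe_finset]).symm
  · simpa [← Finset.coe_subset] using hA
  · have hAS : A ⊆ S := by simpa using hA
    exact ⟨(hS.subset hAS).toFinset, by simpa using hAS, by simp⟩

theorem sum_powerset_neg_one_pow_ncard {R : Type*} [Ring R] (hS : S.Finite) (hne : S.Nonempty) :
    ∑ A ∈ hS.powerset.toFinset, (-1 : R) ^ A.ncard = 0 := by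
  have hsum := Finset.sum_powerset_neg_one_pow_card_of_nonempty (x := hS.toFinset) (by simpa)
  rw [sum_powerset_ncard hS fun n => (-1 : R) ^ n]
  simpa using congrArg (Int.cast : ℤ → R) hsum

end PowersetSums

section LowerHalf

theorem coeff_lowerHalf (r : ℕ) (P : ℤ[X]) (m : ℕ) :
    (lowerHalf r P).coeff m = if 2 * m < r then P.coeff m else 0 := by
  rw [lowerHalf, finsetSum_coeff]
  simp only [coeff_monomial]
  rw [Finset.sum_ite_eq']
  refine if_congr ?_ rfl rfl
  rw [Finset.mem_filter, Finset.mem_range]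
  omega

theorem lowerHalf_sub (r : ℕ) (P Q : ℤ[X]) :
    lowerHalf r (P - Q) = lowerHalf r P - lowerHalf r Q := by
  ext m
  simp only [coeff_sub, coeff_lowerHalf]
  split_ifs <;> simp

theorem lowerHalf_eq_self {r : ℕ} {P : ℤ[X]} (hP : ∀ i, r ≤ 2 * i → P.coeff i = 0) :
    lowerHalf r P = P := by
  ext m
  rw [coeff_lowerHalf]
  split_ifs with hm
  · rfl
  · rw [hP m (by omega)]

theorem lowerHalf_reflect_eq_zero {r : ℕ} {P : ℤ[X]} (hP : ∀ i, r ≤ 2 * i → P.coeff i = 0) :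
    lowerHalf r (reflect r P) = 0 := by
  ext m
  rw [coeff_lowerHalf, coeff_zero, ite_eq_right_iff]
  intro hm
  rw [coeff_reflect, revAt_le (by omega), hP _ (by omega)]

end LowerHalf

section CharPoly

variable {α : Type*} {M : Matroid α} {A : Set α}

theorem charPoly_restrict (hA : A.Finite) : charPoly (M ↾ A) =
    ∑ B ∈ hA.powerset.toFinset, (-1) ^ B.ncard * X ^ (M.natRk A - M.natRk B) := by
  rw [charPoly, restrict_ground_eq, finsum_mem_eq_finite_toFinset_sum _ hA.powerset]
  refine Finset.sum_congr rfl fun B hB => ?_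
  have hBA : B ⊆ A := by simpa using hB
  rw [natRank, natRk, natRk, natRk, eRank_restrict, restrict_eRk_eq M hBA]

theorem charPoly_restrict_of_indep (hA : M.Indep A) (hfin : A.Finite) :
    charPoly (M ↾ A) = (X - 1) ^ A.ncard := by
  have hrank : ∀ B ⊆ A, M.natRk B = B.ncard := fun B hB => by
    rw [natRk, (hA.subset hB).eRk_eq_encard, ncard_def]
  calc charPoly (M ↾ A)
      = ∑ B ∈ hfin.powerset.toFinset, (-1) ^ B.ncard * X ^ (A.ncard - B.ncard) := by
        rw [charPoly_restrict hfin]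
        refine Finset.sum_congr rfl fun B hB => ?_
        rw [hrank A Subset.rfl, hrank B (by simpa using hB)]
    _ = (X - 1) ^ A.ncard := by
        rw [sum_powerset_ncard hfin fun n => (-1 : ℤ[X]) ^ n * X ^ (A.ncard - n),
          ncard_eq_toFinset_card A hfin, Finset.sum_pow_mul_eq_add_pow, neg_add_eq_sub]

theorem ground_nonempty_of_eRank_ne_zero (hr : M.eRank ≠ 0) : M.E.Nonempty := by
  rw [nonempty_iff_ne_empty]
  intro h
  rw [← eRk_ground, h, eRk_empty] at hr
  exact hr rfl

theorem charPoly_of_eRank_eq_one [M.Finite] [M.Loopless] (hr : M.eRank = 1) :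
    charPoly M = X - 1 := by
  classical
  have hE : M.E.Nonempty := ground_nonempty_of_eRank_ne_zero (by simp [hr])
  have hrank : ∀ A ⊆ M.E, A.Nonempty → M.natRk A = 1 := by
    rintro A hA ⟨e, he⟩
    have hle := M.eRk_mono (singleton_subset_iff.2 he)
    rw [(M.isNonloop_of_loopless (hA he)).eRk_eq] at hle
    rw [natRk, ((M.eRk_le_eRank A).trans hr.le).antisymm hle, ENat.toNat_one]
  have hterm : ∀ A ∈ M.ground_finite.powerset.toFinset,
      ((-1) ^ A.ncard * X ^ (M.natRk M.E - M.natRk A) : ℤ[X]) =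
        (-1) ^ A.ncard + if A = ∅ then X - 1 else 0 := by
    intro A hA
    have hAE : A ⊆ M.E := by simpa using hA
    rcases A.eq_empty_or_nonempty with rfl | hne
    · simp [hrank M.E Subset.rfl hE, natRk.eq_1 M ∅]
    · simp [hrank A hAE hne, hrank M.E Subset.rfl hE, hne.ne_empty]
  rw [← restrict_ground_eq_self M, charPoly_restrict M.ground_finite, Finset.sum_congr rfl hterm,
    Finset.sum_add_distrib, sum_powerset_neg_one_pow_ncard M.ground_finite hE, zero_add,
    Finset.sum_ite_eq', if_pos (by simp)]

end CharPoly

section KLPoly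

variable {α : Type*} {M : Matroid α} [M.Finite] {A F H : Set α}

/-- The contribution `χ_{M^A} P_{M_A}` of `A` to the recursion of the Kazhdan–Lusztig polynomials.
It is defined for all sets `A`, and vanishes if `A` is not a flat. -/
noncomputable def klTerm (M : Matroid α) [M.Finite] (A : Set α) : ℤ[X] :=
  charPoly (M ↾ A) * klPoly (M ／ A)

theorem klPoly_congr {N : Matroid α} [N.Finite] (h : M = N) : klPoly M = klPoly N := by
  subst h
  rfl

theorem klPoly_of_ground_eq_empty (h : M.E = ∅) : klPoly M = 1 := by
  have hrank : M.eRank = 0 := by rw [← eRk_ground, h, eRk_empty]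
  rw [klPoly, if_pos hrank, if_pos h]

theorem klPoly_contract_ground : klPoly (M ／ M.E) = 1 := klPoly_of_ground_eq_empty (by simp)

theorem klPoly_eq_zero_of_isLoop {e : α} (he : M.IsLoop e) : klPoly M = 0 := by
  have hchar : ∀ F : {F : Set α // M.IsFlat F ∧ F.Nonempty},
      charPoly (M ↾ F.1) * klPoly (M ／ F.1) = 0 := by
    rintro ⟨F, hF, -⟩
    have hfin : (M ↾ F).Finite := M.restrict_finite (M.ground_finite.subset hF.subset_ground)
    have heF : (M ↾ F).IsLoop e := restrict_isLoop_iff.2 ⟨hF.loops_subset he, Or.inl he⟩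
    rw [charPoly_eq_zero (M ↾ F) heF, zero_mul]
  rw [klPoly, finsum_congr hchar, if_neg (nonempty_of_mem he.mem_ground).ne_empty]
  simp [lowerHalf]

theorem klTerm_eq_zero (hAE : A ⊆ M.E) (hA : ¬ M.IsFlat A) : klTerm M A = 0 := by
  obtain ⟨e, he, heA⟩ := not_subset.1 fun h =>
    hA (isFlat_iff_closure_eq.2 (h.antisymm (M.subset_closure A hAE)))
  rw [klTerm, klPoly_eq_zero_of_isLoop (contract_isLoop_iff_mem_closure.2 ⟨he, heA⟩), mul_zero]

theorem klTerm_eq_zero_of_spanning (hA : M.Spanning A) (hne : A ≠ M.E) : klTerm M A = 0 :=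
  klTerm_eq_zero hA.subset_ground fun h => hne (h.closure ▸ hA.closure_eq)

theorem klTerm_ground (M : Matroid α) [M.Finite] : klTerm M M.E = charPoly M := by
  rw [klTerm, klPoly_contract_ground, restrict_ground_eq_self, mul_one]

open Classical in
theorem klPoly_eq_neg_lowerHalf (hr : M.eRank ≠ 0) :
    klPoly M = -lowerHalf M.natRank
      (∑ A ∈ M.ground_finite.powerset.toFinset.erase ∅, klTerm M A) := by
  have hsum := finsum_set_coe_eq_finsum_mem (f := klTerm M) {F | M.IsFlat F ∧ F.Nonempty}
  rw [klPoly, if_neg hr, ← finsum_mem_eq_sum_of_inter_support_eq, ← hsum]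
  · rfl
  ext A
  rw [mem_inter_iff, mem_inter_iff, and_congr_left_iff]
  intro hA
  have hflat : A ⊆ M.E → M.IsFlat A := fun hAE => not_imp_comm.1 (klTerm_eq_zero hAE) hA
  simpa [nonempty_iff_ne_empty, and_comm] using
    fun _ => ⟨IsFlat.subset_ground, hflat⟩

theorem klPoly_of_eRank_eq_one [M.Loopless] (hr : M.eRank = 1) : klPoly M = 1 := by
  classical
  have hsum : ∑ A ∈ M.ground_finite.powerset.toFinset.erase ∅, klTerm M A = X - 1 := by
    rw [← charPoly_of_eRank_eq_one hr, ← klTerm_ground]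
    refine Finset.sum_eq_single M.E (fun A hA hne => ?_) (fun hE => ?_)
    · obtain ⟨hA0, hAE⟩ : A ≠ ∅ ∧ A ⊆ M.E := by simpa using hA
      obtain ⟨e, he⟩ := nonempty_iff_ne_empty.2 hA0
      refine klTerm_eq_zero_of_spanning ((spanning_iff_eRk_le hAE).2 ?_) hne
      rw [hr, ← (M.isNonloop_of_loopless (hAE he)).eRk_eq]
      exact M.eRk_mono (singleton_subset_iff.2 he)
    · have hE0 : M.E.Nonempty := ground_nonempty_of_eRank_ne_zero (by simp [hr])
      exact absurd hE (by simp [hE0.ne_empty])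
  rw [klPoly_eq_neg_lowerHalf (by simp [hr]), hsum, natRank, hr]
  simp [lowerHalf, Finset.filter_singleton]

theorem klTerm_of_isHyperplane (hH : M.IsHyperplane H) : klTerm M H = charPoly (M ↾ H) := by
  have : (M ／ H).Loopless := by
    rw [loopless_iff, contract_loops_eq, hH.1.closure, sdiff_self]
  rw [klTerm, klPoly_of_eRank_eq_one (eRank_contract_of_isHyperplane hH), mul_one]

end KLPoly

section CharPolyRelax

variable {α : Type*} {M : Matroid α} {H : Set α} {k d : ℕ}

theorem sum_powerset_ncard_eq_binomialShift {f : ℕ → ℤ[X]} (hf : f 0 = 0) (t : ℤ[X])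
    (hfin : H.Finite) (hh : H.encard = (k + d : ℕ)) :
    ∑ A ∈ hfin.powerset.toFinset, t ^ A.ncard * f (k - A.ncard) = binomialShift d t f k := by
  rw [hfin.encard_eq_coe_toFinset_card] at hh
  rw [sum_powerset_ncard hfin fun n => t ^ n * f (k - n),
    sum_powerset_eq_binomialShift hf t (by exact_mod_cast hh)]

theorem eRank_le_encard_of_encard_eq_add (hk : M.eRank = k) (hh : H.encard = (k + d : ℕ)) :
    M.eRank ≤ H.encard := by
  rw [hk, hh]
  exact_mod_cast Nat.le_add_right k d

theorem nonempty_of_isHyperplane (hH : M.IsHyperplane H) (hle : M.eRank ≤ H.encard) :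
    H.Nonempty := by
  rw [nonempty_iff_ne_empty]
  rintro rfl
  rw [encard_empty, ← hH.2] at hle
  exact absurd hle (by simp)

theorem eRank_le_encard_iff {B : Set α} (hB : B.Finite) (hk : M.eRank = k) :
    M.eRank ≤ B.encard ↔ k ≤ B.ncard := by
  rw [hk, ← hB.cast_ncard_eq, Nat.cast_le]

variable [M.Finite]

theorem natRk_of_isHyperplane (hH : M.IsHyperplane H) (hk : M.eRank = k) :
    M.natRk H + 1 = k := by
  have hrank : M.eRk H + 1 = k := hH.2.trans hk
  rw [← ENat.natCast_toNat (M.isRkFinite_set H).eRk_lt_top.ne] at hrank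
  exact_mod_cast hrank

theorem relax_natRk_of_le_ncard (hH : M.IsStressedHyperplane H) (hk : M.eRank = k) {B : Set α}
    (hB : B ⊆ H) (hle : k ≤ B.ncard) :
    (M.relax H hH).natRk B = k ∧ M.natRk B = k - 1 := by
  have hfin : B.Finite := M.ground_finite.subset (hB.trans hH.1.1.subset_ground)
  rw [← eRank_le_encard_iff hfin hk] at hle
  have hrankH := natRk_of_isHyperplane hH.1 hk
  refine ⟨?_, ?_⟩
  · rw [natRk, relax_eRk_of_le_encard hH hB hle, hk, ENat.toNat_natCast]
  · rw [natRk, eRk_of_subset_stressedHyperplane hH hB hle, ← natRk, ← hrankH,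
      Nat.add_sub_cancel]

theorem relax_natRk_eq (hH : M.IsStressedHyperplane H) (hk : M.eRank = k) {B : Set α}
    (hBE : B ⊆ M.E) (h : B ⊆ H → B.ncard < k) : (M.relax H hH).natRk B = M.natRk B := by
  have hfin := M.ground_finite.subset hBE
  rw [natRk, natRk, relax_eRk_eq hH hBE fun hBH => ?_]
  exact not_le.1 ((eRank_le_encard_iff hfin hk).not.2 (h hBH).not_ge)

theorem charPoly_relax_sub_charPoly (hH : M.IsStressedHyperplane H) (hfin : H.Finite)
    (hk : M.eRank = k) :
    charPoly (M.relax H hH) - charPoly M =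
      ∑ B ∈ hfin.powerset.toFinset, if k ≤ B.ncard then (-1) ^ B.ncard * (1 - X) else 0 := by
  classical
  have hsub : hfin.powerset.toFinset ⊆ M.ground_finite.powerset.toFinset := by
    simpa using hH.1.1.subset_ground
  have hchar : charPoly (M.relax H hH) = ∑ B ∈ M.ground_finite.powerset.toFinset,
      (-1) ^ B.ncard * X ^ (M.natRank - (M.relax H hH).natRk B) := by
    rw [charPoly, natRank, relax_eRank, ← natRank]
    exact finsum_mem_eq_finite_toFinset_sum _ M.ground_finite.powerset
  rw [hchar, charPoly, finsum_mem_eq_finite_toFinset_sum _ M.ground_finite.powerset,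
    ← Finset.sum_sub_distrib, natRank, hk, ENat.toNat_natCast]
  refine (Finset.sum_subset_zero_on_sdiff hsub (fun B hB => ?_) fun B hB => ?_).symm
  · obtain ⟨hBE, hBH⟩ : B ⊆ M.E ∧ ¬ B ⊆ H := by simpa using hB
    rw [relax_natRk_eq hH hk hBE fun h => absurd h hBH, sub_self]
  · have hBH : B ⊆ H := by simpa using hB
    split_ifs with hle
    · obtain ⟨hrank', hrank⟩ := relax_natRk_of_le_ncard hH hk hBH hle
      have hpos := natRk_of_isHyperplane hH.1 hk
      rw [hrank', hrank, Nat.sub_self, show k - (k - 1) = 1 by omega]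
      ring
    · rw [relax_natRk_eq hH hk (by simpa using hsub hB) fun _ => not_le.1 hle, sub_self]

theorem charPoly_restrict_stressedHyperplane (hH : M.IsStressedHyperplane H) (hfin : H.Finite)
    (hk : M.eRank = k) (hle : M.eRank ≤ H.encard) :
    charPoly (M ↾ H) = ∑ B ∈ hfin.powerset.toFinset,
      (-1) ^ B.ncard * if k ≤ B.ncard then 1 else X ^ (k - 1 - B.ncard) := by
  have hrankH : M.natRk H = k - 1 := Nat.eq_sub_of_add_eq (natRk_of_isHyperplane hH.1 hk)
  rw [charPoly_restrict hfin, hrankH]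
  refine Finset.sum_congr rfl fun B hB => ?_
  have hBH : B ⊆ H := by simpa using hB
  split_ifs with h
  · rw [(relax_natRk_of_le_ncard hH hk hBH h).2, Nat.sub_self, pow_zero]
  · rw [← eRank_le_encard_iff (hfin.subset hBH) hk, not_le] at h
    rw [natRk, (indep_of_subset_stressedHyperplane hH hle hBH h).eRk_eq_encard, ← ncard_def]

theorem charPoly_relax (hH : M.IsStressedHyperplane H) (hk : M.eRank = k)
    (hh : H.encard = (k + d : ℕ)) :
    charPoly (M.relax H hH) - charPoly M - charPoly (M ↾ H) = -binomialShift d (-1) defect k := by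
  have hfin : H.Finite := M.ground_finite.subset hH.1.1.subset_ground
  have hle := eRank_le_encard_of_encard_eq_add hk hh
  have hne := nonempty_of_isHyperplane hH.1 hle
  rw [charPoly_relax_sub_charPoly hH hfin hk, charPoly_restrict_stressedHyperplane hH hfin hk hle,
    ← Finset.sum_sub_distrib]
  calc _ = ∑ B ∈ hfin.powerset.toFinset,
        (-X * (-1) ^ B.ncard - (-1) ^ B.ncard * defect (k - B.ncard)) := by
        refine Finset.sum_congr rfl fun B _ => ?_
        rw [defect]
        split_ifs with h h' h'
        · ring
        · omega
        · omega
        · rw [Nat.sub_right_comm]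
          ring
    _ = -binomialShift d (-1) defect k := by
        rw [Finset.sum_sub_distrib, ← Finset.mul_sum, sum_powerset_neg_one_pow_ncard hfin hne,
          mul_zero, zero_sub,
          sum_powerset_ncard_eq_binomialShift (by simp [defect]) _ hfin hh]

end CharPolyRelax

section Recursion

variable {α : Type u} {M : Matroid α} [M.Finite] {A H : Set α} {k d : ℕ} {p : ℕ → ℤ[X]}

theorem klTerm_of_indep (hA : M.Indep A) :
    klTerm M A = (X - 1) ^ A.ncard * klPoly (M ／ A) := by
  rw [klTerm, charPoly_restrict_of_indep hA (M.ground_finite.subset hA.subset_ground)]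

theorem klPoly_relax_contract (hH : M.IsStressedHyperplane H) (hk : M.eRank = k)
    (hh : H.encard = (k + d : ℕ)) (hA : A ⊆ H) (hlt : A.ncard < k) {q : ℤ[X]}
    (hq : IsKLRelaxationPoly.{u} (k - A.ncard) (k - A.ncard + d) q) :
    klPoly (M.relax H hH ／ A) = klPoly (M ／ A) + q := by
  have hfin : A.Finite := M.ground_finite.subset (hA.trans hH.1.1.subset_ground)
  have hle := eRank_le_encard_of_encard_eq_add hk hh
  have hlt' : A.encard < M.eRank := not_le.1 ((eRank_le_encard_iff hfin hk).not.2 hlt.not_ge)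
  have hrank := eRank_contract_add_encard (indep_of_subset_stressedHyperplane hH hle hA hlt')
  have hcard := encard_sdiff_add_encard_of_subset hA
  rw [klPoly_congr (relax_contract_eq_relax hH hA hle hlt')]
  refine hq _ _ _ _ (ENat.add_left_injective_of_ne_top hlt'.ne_top ?_)
    (ENat.add_left_injective_of_ne_top hlt'.ne_top ?_)
  · change _ + _ = _ + _
    rw [hrank, hk, ← hfin.cast_ncard_eq]
    norm_cast
    omega
  · change _ + _ = _ + _
    rw [hcard, hh, ← hfin.cast_ncard_eq]
    norm_cast
    omega

open Classical in
theorem klTerm_relax_sub_of_subset (hH : M.IsStressedHyperplane H) (hk : M.eRank = k)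
    (hh : H.encard = (k + d : ℕ)) (hp0 : p 0 = 0)
    (ih : ∀ k' < k, IsKLRelaxationPoly.{u} k' (k' + d) (p k')) (hA : A ⊆ H) (hne : A.Nonempty) :
    klTerm (M.relax H hH) A - klTerm M A =
      (X - 1) ^ A.ncard * p (k - A.ncard) - if A = H then charPoly (M ↾ H) else 0 := by
  have hHE := hH.1.1.subset_ground
  have hfin : A.Finite := M.ground_finite.subset (hA.trans hHE)
  have hle := eRank_le_encard_of_encard_eq_add hk hh
  rcases lt_or_ge A.encard M.eRank with hlt | hge
  · have hAi := indep_of_subset_stressedHyperplane hH hle hA hlt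
    have hAi' : (M.relax H hH).Indep A := (relax_indep_iff hH).2 (Or.inl hAi)
    have hltk := not_le.1 ((eRank_le_encard_iff hfin hk).not.1 hlt.not_ge)
    have hpos : 0 < A.ncard := (ncard_pos hfin).2 hne
    rw [klTerm_of_indep hAi, klTerm_of_indep hAi',
      klPoly_relax_contract hH hk hh hA hltk (ih _ (by omega)),
      if_neg (by rintro rfl; exact hlt.not_ge hle)]
    ring
  · have hspan : (M.relax H hH).Spanning A := by
      rw [spanning_iff_eRk_le (M := M.relax H hH) (hA.trans hHE),
        relax_eRk_of_le_encard hH hA hge, relax_eRank]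
    have hAE : A ≠ M.E := (hA.trans_ssubset (ssubset_ground_of_isHyperplane hH.1)).ne
    rw [klTerm_eq_zero_of_spanning hspan hAE,
      Nat.sub_eq_zero_of_le ((eRank_le_encard_iff hfin hk).1 hge), hp0, mul_zero]
    split_ifs with hAH
    · rw [hAH, klTerm_of_isHyperplane hH.1]
    · rw [klTerm_eq_zero (hA.trans hHE), sub_zero]
      exact fun h => hAH (h.closure ▸ closure_of_subset_stressedHyperplane hH hA hge)

theorem klTerm_relax_eq_of_not_subset (hH : M.IsStressedHyperplane H) (hAE : A ⊆ M.E)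
    (hA : ¬ A ⊆ H) (hne : A ≠ M.E) : klTerm (M.relax H hH) A = klTerm M A := by
  rcases (M.eRk_le_eRank A).lt_or_eq with hlt | heq
  · rw [klTerm, klTerm, klPoly_congr (relax_contract_eq hH hAE hA),
      relax_restrict_eq hH hAE hA hlt]
  · have hspan : (M.relax H hH).Spanning A := by
      rw [spanning_iff_eRk_le (M := M.relax H hH) hAE, relax_eRk_eq hH hAE fun h => absurd h hA,
        relax_eRank, heq]
    rw [klTerm_eq_zero_of_spanning hspan hne,
      klTerm_eq_zero_of_spanning ((spanning_iff_eRk_le hAE).2 heq.ge) hne]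

open Classical in
theorem sum_klTerm_relax_sub_of_subset (hH : M.IsStressedHyperplane H) (hfin : H.Finite)
    (hk : M.eRank = k) (hh : H.encard = (k + d : ℕ)) (hp0 : p 0 = 0)
    (ih : ∀ k' < k, IsKLRelaxationPoly.{u} k' (k' + d) (p k')) :
    ∑ A ∈ hfin.powerset.toFinset.erase ∅, (klTerm (M.relax H hH) A - klTerm M A) =
      binomialShift d (X - 1) p k - p k - charPoly (M ↾ H) := by
  have hne := nonempty_of_isHyperplane hH.1 (eRank_le_encard_of_encard_eq_add hk hh)
  have hterm : ∀ A ∈ hfin.powerset.toFinset.erase ∅, klTerm (M.relax H hH) A - klTerm M A =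
      (X - 1) ^ A.ncard * p (k - A.ncard) - if A = H then charPoly (M ↾ H) else 0 := by
    intro A hA
    obtain ⟨hA0, hAH⟩ : A ≠ ∅ ∧ A ⊆ H := by simpa using hA
    exact klTerm_relax_sub_of_subset hH hk hh hp0 ih hAH (nonempty_iff_ne_empty.2 hA0)
  rw [Finset.sum_congr rfl hterm, Finset.sum_sub_distrib, Finset.sum_ite_eq',
    if_pos (by simp [hne.ne_empty]), Finset.sum_erase_eq_sub (by simp),
    sum_powerset_ncard_eq_binomialShift hp0 _ hfin hh, ncard_empty, pow_zero, one_mul,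
    Nat.sub_zero]

open Classical in
theorem sum_klTerm_relax_sub_of_not_subset (hH : M.IsStressedHyperplane H) :
    ∑ A ∈ M.ground_finite.powerset.toFinset.filter (¬ · ⊆ H),
      (klTerm (M.relax H hH) A - klTerm M A) = charPoly (M.relax H hH) - charPoly M := by
  have hHE := (ssubset_ground_of_isHyperplane hH.1).not_subset
  rw [← klTerm_ground M, ← klTerm_ground (M.relax H hH)]
  refine Finset.sum_eq_single M.E (fun A hA hne => ?_) fun hE => absurd hE (by simpa using hHE)
  obtain ⟨hAE, hAH⟩ : A ⊆ M.E ∧ ¬ A ⊆ H := by simpa using hA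
  rw [klTerm_relax_eq_of_not_subset hH hAE hAH hne, sub_self]

open Classical in
theorem sum_klTerm_relax_sub (hH : M.IsStressedHyperplane H) (hk : M.eRank = k)
    (hh : H.encard = (k + d : ℕ)) (hp0 : p 0 = 0)
    (ih : ∀ k' < k, IsKLRelaxationPoly.{u} k' (k' + d) (p k')) :
    ∑ A ∈ M.ground_finite.powerset.toFinset.erase ∅, (klTerm (M.relax H hH) A - klTerm M A) =
      binomialShift d (X - 1) p k - binomialShift d (-1) defect k - p k := by
  have hHE := hH.1.1.subset_ground
  have hfin := M.ground_finite.subset hHE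
  have hinside : (M.ground_finite.powerset.toFinset.erase ∅).filter (· ⊆ H) =
      hfin.powerset.toFinset.erase ∅ := by
    ext A
    simpa [and_assoc] using fun _ (h : A ⊆ H) => h.trans hHE
  have houtside : (M.ground_finite.powerset.toFinset.erase ∅).filter (¬ · ⊆ H) =
      M.ground_finite.powerset.toFinset.filter (¬ · ⊆ H) := by
    rw [Finset.filter_erase, Finset.erase_eq_of_notMem (by simp)]
  rw [← Finset.sum_filter_add_sum_filter_not _ (· ⊆ H), hinside, houtside,
    sum_klTerm_relax_sub_of_subset hH hfin hk hh hp0 ih, sum_klTerm_relax_sub_of_not_subset hH]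
  linear_combination charPoly_relax hH hk hh

theorem isKLRelaxationPoly_of_recursion (hcoeff : ∀ k i, k ≤ 2 * i → (p k).coeff i = 0)
    (hrec : ∀ k, binomialShift d (X - 1) p k - binomialShift d (-1) defect k = reflect k (p k))
    (k : ℕ) : IsKLRelaxationPoly.{u} k (k + d) (p k) := by
  classical
  induction k using Nat.strong_induction_on with
  | _ k ih =>
  intro α M _ H hH hk hh
  have hp0 : p 0 = 0 := ext fun i => hcoeff 0 i (Nat.zero_le _)
  have hsum := sum_klTerm_relax_sub hH hk hh hp0 ih
  have hrank : M.eRank ≠ 0 := hH.1.2 ▸ by simp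
  have hrelax : klPoly (M.relax H hH) = -lowerHalf (M.relax H hH).natRank
      (∑ A ∈ M.ground_finite.powerset.toFinset.erase ∅, klTerm (M.relax H hH) A) :=
    klPoly_eq_neg_lowerHalf (by rwa [relax_eRank])
  rw [natRank, relax_eRank, hk, ENat.toNat_natCast] at hrelax
  rw [hrec, Finset.sum_sub_distrib] at hsum
  have hlower := congrArg (lowerHalf k) hsum
  rw [lowerHalf_sub, lowerHalf_sub, lowerHalf_reflect_eq_zero (hcoeff k),
    lowerHalf_eq_self (hcoeff k)] at hlower
  rw [hrelax, klPoly_eq_neg_lowerHalf hrank, natRank, hk, ENat.toNat_natCast]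
  linear_combination -hlower

end Recursion

section Uniqueness

variable {α : Type*} [Finite α] {x : α} {r : ℕ} {I J S : Set α}

theorem exists_ncard_insert_sdiff_singleton_le (hI : (I \ {x}).ncard ≤ r)
    (hJ : (J \ {x}).ncard ≤ r) (hlt : I.ncard < J.ncard) :
    ∃ e ∈ J, e ∉ I ∧ (insert e I \ {x}).ncard ≤ r := by
  by_cases hx : x ∈ J ∧ x ∉ I
  · refine ⟨x, hx.1, hx.2, ?_⟩
    rwa [insert_sdiff_of_mem _ (mem_singleton x)]
  have hcard : (I \ {x}).ncard < (J \ {x}).ncard := by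
    by_cases hxJ : x ∈ J
    · have hxI : x ∈ I := by tauto
      have hIcard := ncard_sdiff_singleton_add_one hxI
      have hJcard := ncard_sdiff_singleton_add_one hxJ
      omega
    · rw [sdiff_singleton_eq_self hxJ]
      exact (ncard_le_ncard sdiff_subset).trans_lt hlt
  obtain ⟨e, he, heI⟩ := exists_mem_notMem_of_ncard_lt_ncard hcard
  refine ⟨e, he.1, fun h => heI ⟨h, he.2⟩, ?_⟩
  rw [insert_sdiff_of_notMem _ he.2]
  exact (ncard_insert_le _ _).trans (by omega)

/-- The matroid on a finite type in which `x` is a coloop whose deletion is uniform of rank `r`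
(of full rank, if there are fewer than `r` other elements). The complement of `x` is a stressed
hyperplane, so that these matroids test all pairs `(k, h)` with `1 ≤ k ≤ h + 1`. -/
def uniformWithColoop (x : α) (r : ℕ) : Matroid α :=
  (IndepMatroid.ofFinite finite_univ (fun I => (I \ {x}).ncard ≤ r) (by simp)
    (fun _ _ hJ hIJ => (ncard_le_ncard (sdiff_subset_sdiff_left hIJ)).trans hJ)
    (fun _ _ => exists_ncard_insert_sdiff_singleton_le) (fun _ _ => subset_univ _)).matroid

theorem uniformWithColoop_indep_iff : (uniformWithColoop x r).Indep I ↔ (I \ {x}).ncard ≤ r := by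
  simp [uniformWithColoop]

theorem uniformWithColoop_indep_iff_of_notMem (hx : x ∉ I) :
    (uniformWithColoop x r).Indep I ↔ I.ncard ≤ r := by
  rw [uniformWithColoop_indep_iff, sdiff_singleton_eq_self hx]

theorem uniformWithColoop_ground (x : α) (r : ℕ) : (uniformWithColoop x r).E = univ := rfl

instance uniformWithColoop_finite (x : α) (r : ℕ) : (uniformWithColoop x r).Finite :=
  ⟨finite_univ⟩

theorem uniformWithColoop_isColoop (x : α) (r : ℕ) : (uniformWithColoop x r).IsColoop x := by
  rw [isColoop_iff_forall_mem_isBase]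
  intro B hB
  by_contra hxB
  have hind : (uniformWithColoop x r).Indep (insert x B) := by
    have hBi := hB.indep
    rw [uniformWithColoop_indep_iff] at hBi ⊢
    rwa [insert_sdiff_of_mem _ (mem_singleton x)]
  exact hxB (hB.eq_of_subset_indep hind (subset_insert x B) ▸ mem_insert x B)

theorem uniformWithColoop_eRk_compl (hr : r ≤ ({x}ᶜ : Set α).ncard) :
    (uniformWithColoop x r).eRk {x}ᶜ = r := by
  refine le_antisymm ?_ ?_
  · rw [eRk_le_iff]
    intro I hI hIi
    rw [uniformWithColoop_indep_iff_of_notMem fun h => hI h rfl] at hIi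
    rw [← I.toFinite.cast_ncard_eq]
    exact_mod_cast hIi
  · obtain ⟨S, hS, hSr⟩ := exists_subset_card_eq hr
    rw [le_eRk_iff]
    refine ⟨S, hS, (uniformWithColoop_indep_iff_of_notMem fun h => hS h rfl).2 hSr.le, ?_⟩
    rw [← S.toFinite.cast_ncard_eq, hSr]

theorem uniformWithColoop_eRank (hr : r ≤ ({x}ᶜ : Set α).ncard) :
    (uniformWithColoop x r).eRank = (r + 1 : ℕ) := by
  have hcl : x ∉ (uniformWithColoop x r).closure {x}ᶜ :=
    (uniformWithColoop_isColoop x r).notMem_closure_of_notMem (by simp)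
  rw [← eRk_ground, uniformWithColoop_ground, ← union_compl_self {x}, ← insert_eq,
    eRk_insert_eq_add_one ⟨mem_univ x, hcl⟩, uniformWithColoop_eRk_compl hr, Nat.cast_add,
    Nat.cast_one]

theorem uniformWithColoop_isStressedHyperplane (hr : r ≤ ({x}ᶜ : Set α).ncard) :
    (uniformWithColoop x r).IsStressedHyperplane {x}ᶜ := by
  refine ⟨⟨?_, ?_⟩, ?_⟩
  · have hcl := (uniformWithColoop_isColoop x r).notMem_closure_of_notMem (X := {x}ᶜ) (by simp)
    exact isFlat_iff_closure_eq.2 (Subset.antisymm (subset_compl_singleton_iff.2 hcl)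
      (subset_closure _ _ (subset_univ _)))
  · rw [uniformWithColoop_eRk_compl hr, uniformWithColoop_eRank hr, Nat.cast_add, Nat.cast_one]
  · intro S hS hSr
    rw [uniformWithColoop_eRank hr, ← S.toFinite.cast_ncard_eq, Nat.cast_inj] at hSr
    have hxS : x ∉ S := fun h => hS h rfl
    rw [isCircuit_iff_dep_forall_sdiff_singleton_indep]
    refine ⟨⟨?_, subset_univ _⟩, fun e he => ?_⟩
    · rw [uniformWithColoop_indep_iff_of_notMem hxS]
      omega
    · have hcard := ncard_sdiff_singleton_add_one he
      exact (uniformWithColoop_indep_iff_of_notMem fun h => hxS h.1).2 (by omega)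

theorem isKLRelaxationPoly_unique {k h : ℕ} {p q : ℤ[X]} (hk : 1 ≤ k) (hkh : k ≤ h + 1)
    (hp : IsKLRelaxationPoly.{u} k h p) (hq : IsKLRelaxationPoly.{u} k h q) : p = q := by
  have hcard : ({none}ᶜ : Set (Option (ULift.{u} (Fin h)))).ncard = h := by
    rw [ncard_compl, ncard_singleton, Nat.card_eq_fintype_card]
    simp
  have hr : k - 1 ≤ ({none}ᶜ : Set (Option (ULift.{u} (Fin h)))).ncard := by omega
  have hencard : ({none}ᶜ : Set (Option (ULift.{u} (Fin h)))).encard = h := by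
    rw [← (toFinite _).cast_ncard_eq, hcard]
  have hrank := uniformWithColoop_eRank hr
  rw [Nat.sub_add_cancel hk] at hrank
  have hH := uniformWithColoop_isStressedHyperplane hr
  exact add_left_cancel ((hp _ _ _ hH hrank hencard).symm.trans (hq _ _ _ hH hrank hencard))

end Uniqueness

section Existence

theorem isKLRelaxationPoly_zero (h : ℕ) : IsKLRelaxationPoly.{u} (h + 1) h 0 := by
  intro α M _ H hH hk hh
  have hlt : H.encard < M.eRank := by
    rw [hk, hh]
    exact_mod_cast h.lt_succ_self
  rw [add_zero, klPoly_congr (relax_eq_self hH hlt)]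

theorem isKLRelaxationPoly_relaxPoly (k d : ℕ) :
    IsKLRelaxationPoly.{u} k (k + d) (relaxPoly d k) :=
  isKLRelaxationPoly_of_recursion (fun _ _ => coeff_relaxPoly_eq_zero)
    (binomialShift_relaxPoly_sub_binomialShift_defect d) k

end Existence

end KLRelaxation

open KLRelaxation

theorem mainTheorem11 (k h : ℕ) (hk : 1 ≤ k) (hh : 1 ≤ h) (hkh : k ≤ h + 1) :
    (∃! p : ℤ[X], IsKLRelaxationPoly.{u} k h p) ∧
    ∀ p : ℤ[X], IsKLRelaxationPoly.{u} k h p →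
      (2 ≤ k → p = ∑ i ∈ Finset.range ((k - 1) / 2 + 1),
        C (skytBar (h + 2 - k) i (k + 1 - 2 * i) : ℤ) * X ^ i) ∧
      (k = 1 → p = 1) ∧
      (∀ i, 0 ≤ p.coeff i) ∧
      (k = 2 ∨ k = h + 1 → p = 0) ∧
      (k ≠ 2 → k ≤ h → p.degree = ((k - 1) / 2 : ℕ)) := by
  rcases Nat.lt_or_ge h k with hlt | hge
  · obtain rfl : k = h + 1 := by omega
    have hzero := isKLRelaxationPoly_zero.{u} h
    refine ⟨⟨0, hzero, fun q hq => isKLRelaxationPoly_unique hk hkh hq hzero⟩, fun p hp => ?_⟩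
    obtain rfl := isKLRelaxationPoly_unique hk hkh hp hzero
    have hskyt (i b : ℕ) : skytBar (h + 2 - (h + 1)) i b = 0 := by
      rw [skytBar, if_pos (by omega)]
    exact ⟨fun _ => by simp only [hskyt, Nat.cast_zero, C_0, zero_mul, Finset.sum_const_zero],
      by omega, by simp, by simp, by omega⟩
  · obtain ⟨d, rfl⟩ := Nat.exists_eq_add_of_le hge
    have hrelax := isKLRelaxationPoly_relaxPoly.{u} k d
    refine ⟨⟨_, hrelax, fun q hq => isKLRelaxationPoly_unique hk hkh hq hrelax⟩, fun p hp => ?_⟩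
    obtain rfl := isKLRelaxationPoly_unique hk hkh hp hrelax
    refine ⟨fun hk2 => ?_, fun hk1 => if_pos hk1, fun i => coeff_relaxPoly_nonneg, fun hk2 => ?_,
      fun hk2 _ => degree_relaxPoly hk hk2⟩
    · rw [relaxPoly, if_neg (by omega), show k + d + 2 - k = d + 2 by omega]
    · rw [show k = 2 by omega, relaxPoly_two]
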